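/- Let $\mathrm{PSL}_2(\mathbb C)$ act on $\mathbb P^1=\mathbb C\cup\{\infty\}$ by Möbius transformations. Let $G\subset \mathrm{PSL}_2(\mathbb C)$ be a finite subgroup, let $\mathbb C(z)^G$ be the field of rational functions $v\in\mathbb C(z)$, viewed as maps $\mathbb P^1\to\mathbb P^1$, with $v\circ g=v$ for all $g\in G$, and let $u$ be a generator of $\mathbb C(z)^G$, that is, $\mathbb C(u)=\mathbb C(z)^G$. For $p\in\mathbb P^1$ let $\operatorname{mult}_p u$ be the order of vanishing at $p$ of $u-u(p)$, computed in local coordinates of $\mathbb P^1$ at $p$ and at $u(p)$ (using the coordinate $1/z$ at $\infty$). A branch point of $u$ is a point $p$ with $\operatorname{mult}_p u>1$, and a branch value of $u$ is the image $u(p)$ of a branch point. Then the following hold. 1. If $G$ is not cyclic, then $u$ has exactly three branch values. If $G$ is cyclic and nontrivial, then $u$ has exactly two branch values. 2. For all $p,q\in\mathbb P^1$ with $u(p)=u(q)$ we have $\operatorname{mult}_p u=\operatorname{mult}_q u$. 3. The branch values of $u$ can be numbered $b_1,\dots,b_k$ (pairwise distinct) so that $u$ has multiplicity $m_i$ at every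 point of $u^{-1}(b_i)$, $1\le i\le k$, where - $(m_1,m_2)=(n,n)$ if $G\cong\mathbb Z_n$ with $n\ge 2$; - $(m_1,m_2,m_3)=(2,2,n)$ if $G\cong D_n$, the dihedral group of order $2n$, with $n\ge 2$; - $(m_1,m_2,m_3)=(3,3,2)$ if $G\cong A_4$; - $(m_1,m_2,m_3)=(4,3,2)$ if $G\cong S_4$; - $(m_1,m_2,m_3)=(5,3,2)$ if $G\cong A_5$. -/

import Mathlib

open scoped MatrixGroups

noncomputable section

namespace MobiusInvariant

/-- The action of `PSL(2, ℂ)` on `ℂ ∪ {∞}` by Möbius transformations, transported from the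
projective line `ℙ ℂ (Fin 2 → ℂ)`. -/
instance instMobiusAction : MulAction PSL(2, ℂ) (OnePoint ℂ) :=
  (OnePoint.equivProjectivization ℂ).mulAction PSL(2, ℂ)

/-- The map `ℂ ∪ {∞} → ℂ ∪ {∞}` given by a rational function `u = P / Q` in lowest terms. The
value at `∞` is the quotient of the coefficients of degree `max (deg P) (deg Q)`. -/
def toMap (u : RatFunc ℂ) : OnePoint ℂ → OnePoint ℂ
  | OnePoint.some z =>
      if u.denom.eval z = 0 then OnePoint.infty
      else ((u.num.eval z / u.denom.eval z : ℂ) : OnePoint ℂ)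
  | OnePoint.infty =>
      let d := max u.num.natDegree u.denom.natDegree
      if u.denom.coeff d = 0 then OnePoint.infty
      else ((u.num.coeff d / u.denom.coeff d : ℂ) : OnePoint ℂ)

/-- The rational functions `v` with `v ∘ g = v` for all `g ∈ G`. -/
def invariants (G : Subgroup PSL(2, ℂ)) : Set (RatFunc ℂ) :=
  {v | ∀ g ∈ G, ∀ p : OnePoint ℂ, toMap v (g • p) = toMap v p}

/-- `u` generates the field of `G`-invariant rational functions over `ℂ`. -/
def IsInvariantGenerator (G : Subgroup PSL(2, ℂ)) (u : RatFunc ℂ) : Prop :=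
  (IntermediateField.adjoin ℂ {u} : Set (RatFunc ℂ)) = invariants G

/-- The inverse of a local coordinate of `ℂ ∪ {∞}` centred at `p`: it sends `z` near `0` to `p + z`
if `p` is finite, and to `1 / z` if `p = ∞`. -/
def localParam : OnePoint ℂ → ℂ → OnePoint ℂ
  | OnePoint.some p => fun z => ((p + z : ℂ) : OnePoint ℂ)
  | OnePoint.infty => fun z => if z = 0 then OnePoint.infty else ((z⁻¹ : ℂ) : OnePoint ℂ)

/-- A local coordinate of `ℂ ∪ {∞}` centred at `q`, namely `w - q` if `q` is finite and `1 / w` if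
`q = ∞`. Only its values near `q` are meaningful. -/
def localCoord : OnePoint ℂ → OnePoint ℂ → ℂ
  | OnePoint.some q, OnePoint.some w => w - q
  | OnePoint.some _, OnePoint.infty => 0
  | OnePoint.infty, OnePoint.some w => w⁻¹
  | OnePoint.infty, OnePoint.infty => 0

/-- The multiplicity of `u` at `p`: the order of vanishing at `0` of the expression of `u` in local
coordinates centred at `p` and at `u(p)`. -/
def mult (u : RatFunc ℂ) (p : OnePoint ℂ) : ℕ∞ :=
  analyticOrderAt (fun z : ℂ => localCoord (toMap u p) (toMap u (localParam p z))) 0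

/-- The images of the points at which `u` has multiplicity greater than one. -/
def branchValues (u : RatFunc ℂ) : Set (OnePoint ℂ) :=
  toMap u '' {p | 1 < mult u p}

/-- `u` has exactly `k` branch values, and these can be numbered so that `u` has multiplicity `m i`
at every point over the `i`-th one. -/
def HasBranchMultiplicities (u : RatFunc ℂ) {k : ℕ} (m : Fin k → ℕ) : Prop :=
  ∃ b : Fin k → OnePoint ℂ, Function.Injective b ∧ Set.range b = branchValues u ∧
    ∀ i p, toMap u p = b i → mult u p = m i

end MobiusInvariant

end

/-! The fibres of `u` are the orbits of `G`, and the multiplicity of `u` at `p` is the order of the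
stabilizer of `p`; everything else is counting.

Both facts rest on one explicit invariant. For `a` and `b` in different orbits, `orbitRat` is the
quotient of two products of linear forms, vanishing at the points `g • a` and `g • b` respectively.
Being in `ℂ(u)`, it factors as `R ∘ u`. Its values `0` at `a` and `∞` at `b` show that `u` separates
orbits, and multiplicativity of local orders gives `mult_le`. Conversely, the stabilizer of `p` acts
on the tangent line at `p` through a faithful character, because a nontrivial element of finite
order is not parabolic. Hence the stabilizer is cyclic, and comparing leading terms of `u` at `p`
shows that the character is killed by the power `mult u p`. This gives the other inequality
(`mult_eq_card`).

Every nontrivial element of `G` has exactly two fixed points. Counting pairs (element, fixed point)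
gives Riemann–Hurwitz: the sum of `1 - 1/m_b` over the branch values is `2 - 2/|G|`. Arithmetic
leaves two values with `m = |G|`, or three with indices (2,2,n), (2,3,3), (2,3,4), (2,3,5) and `|G|`
equal to 2n, 12, 24, 60. Each index is the order of an element, and the order of each nontrivial
element divides an index; this matches isomorphism types with cases. -/

noncomputable section

namespace MobiusInvariant

open Filter Topology

/-! ### Homogeneous coordinates and the Möbius action. -/

/-- The point of `ℂ ∪ {∞}` with homogeneous coordinates `(x : y)`. -/
def ptOf (x y : ℂ) : OnePoint ℂ :=
  if y = 0 then OnePoint.infty else ((x / y : ℂ) : OnePoint ℂ)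

theorem ptOf_eq_iff {x y x' y' : ℂ} (h : x ≠ 0 ∨ y ≠ 0) (h' : x' ≠ 0 ∨ y' ≠ 0) :
    ptOf x y = ptOf x' y' ↔ x * y' = x' * y := by
  unfold ptOf
  by_cases hy : y = 0 <;> by_cases hy' : y' = 0
  · simp [hy, hy']
  · have : x ≠ 0 := by tauto
    simp [hy, hy', this]
  · have : x' ≠ 0 := by tauto
    simp [hy, hy', this]
  · simp only [hy, hy', if_false, OnePoint.coe_eq_coe]
    rw [div_eq_div_iff hy hy']

theorem ptOf_mul {c : ℂ} (hc : c ≠ 0) (x y : ℂ) : ptOf (c * x) (c * y) = ptOf x y := by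
  unfold ptOf
  by_cases hy : y = 0
  · simp [hy]
  · simp [hy, hc, mul_div_mul_left]

/-- The first homogeneous coordinate of `localParam p z`. -/
def coordX : OnePoint ℂ → ℂ → ℂ
  | OnePoint.some p => fun z => p + z
  | OnePoint.infty => fun _ => 1

/-- The second homogeneous coordinate of `localParam p z`. -/
def coordY : OnePoint ℂ → ℂ → ℂ
  | OnePoint.some _ => fun _ => 1
  | OnePoint.infty => fun z => z

theorem localParam_eq_ptOf (p : OnePoint ℂ) (z : ℂ) :
    localParam p z = ptOf (coordX p z) (coordY p z) := by
  cases p with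
  | infty => simp [localParam, ptOf, coordX, coordY]
  | coe p => simp [localParam, ptOf, coordX, coordY]

theorem coord_ne_zero (p : OnePoint ℂ) (z : ℂ) : coordX p z ≠ 0 ∨ coordY p z ≠ 0 := by
  cases p with
  | infty => simp [coordX]
  | coe p => simp [coordY]

@[simp]
theorem localParam_zero (p : OnePoint ℂ) : localParam p 0 = p := by
  cases p with
  | infty => simp [localParam]
  | coe p => simp [localParam]

theorem ptOf_coord (p : OnePoint ℂ) : ptOf (coordX p 0) (coordY p 0) = p := by
  rw [← localParam_eq_ptOf, localParam_zero]

theorem ptOf_eq_self_iff {x y : ℂ} (h : x ≠ 0 ∨ y ≠ 0) (p : OnePoint ℂ) :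
    ptOf x y = p ↔ x * coordY p 0 = coordX p 0 * y := by
  conv_lhs => rw [← ptOf_coord p]
  exact ptOf_eq_iff h (coord_ne_zero p 0)

theorem analyticAt_coordX (p : OnePoint ℂ) (z : ℂ) : AnalyticAt ℂ (coordX p) z := by
  cases p with
  | infty => exact analyticAt_const
  | coe p => exact analyticAt_const.add analyticAt_id

theorem analyticAt_coordY (p : OnePoint ℂ) (z : ℂ) : AnalyticAt ℂ (coordY p) z := by
  cases p with
  | infty => exact analyticAt_id
  | coe p => exact analyticAt_const

theorem localParam_injective (p : OnePoint ℂ) : Function.Injective (localParam p) := by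
  intro z w h
  rw [localParam_eq_ptOf, localParam_eq_ptOf,
    ptOf_eq_iff (coord_ne_zero p z) (coord_ne_zero p w)] at h
  cases p with
  | infty => simpa [coordX, coordY, eq_comm] using h
  | coe p => simpa [coordX, coordY] using h

/-- Used to extend identities across finitely many exceptional points by continuity. -/
theorem eventually_localParam_notMem (p : OnePoint ℂ) {S : Set (OnePoint ℂ)} (hS : S.Finite) :
    ∀ᶠ z in 𝓝[≠] (0 : ℂ), localParam p z ∉ S := by
  have hfin : (localParam p ⁻¹' S).Finite := hS.preimage (localParam_injective p).injOn
  have h1 : (localParam p ⁻¹' S \ {0})ᶜ ∈ 𝓝 (0 : ℂ) :=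
    (hfin.subset Set.sdiff_subset).isClosed.isOpen_compl.mem_nhds (by simp)
  rw [eventually_nhdsWithin_iff]
  filter_upwards [h1] with z hz hz0 hzS
  exact hz ⟨hzS, hz0⟩

theorem sl_smul_ptOf (A : SL(2, ℂ)) {x y : ℂ} (h : x ≠ 0 ∨ y ≠ 0) :
    (A : PSL(2, ℂ)) • ptOf x y = ptOf (A 0 0 * x + A 0 1 * y) (A 1 0 * x + A 1 1 * y) := by
  have hv : (![x, y] : Fin 2 → ℂ) ≠ 0 := by
    intro h0
    have := congrFun h0 0
    have := congrFun h0 1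
    simp_all
  have hE : ∀ (x y : ℂ) (hv : (![x, y] : Fin 2 → ℂ) ≠ 0),
      (OnePoint.equivProjectivization ℂ).symm (Projectivization.mk ℂ ![x, y] hv) = ptOf x y := by
    intro x y hv
    rw [OnePoint.equivProjectivization_symm_apply_mk]
    by_cases hy : y = 0
    · simp [hy, ptOf]
    · simp [hy, ptOf, div_eq_inv_mul]
  rw [← hE x y hv]
  change (OnePoint.equivProjectivization ℂ).symm ((A : PSL(2, ℂ)) •
    (OnePoint.equivProjectivization ℂ) _) = _
  rw [Equiv.apply_symm_apply, Matrix.ProjectiveSpecialLinearGroup.smul_proj_mk,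
    Projectivization.smul_mk]
  have hA : A • (![x, y] : Fin 2 → ℂ) =
      ![A 0 0 * x + A 0 1 * y, A 1 0 * x + A 1 1 * y] := by
    change A.1.mulVec ![x, y] = _
    rw [Matrix.mulVec_fin_two]
    simp
  rw [← hE _ _ (by rw [← hA]; exact (smul_ne_zero_iff_ne A).mpr hv)]
  congr 1
  simp only [hA]

theorem sl_det (A : SL(2, ℂ)) : A 0 0 * A 1 1 - A 0 1 * A 1 0 = 1 := by
  have := A.det_coe
  rwa [Matrix.det_fin_two] at this

theorem sl_apply_ne_zero (A : SL(2, ℂ)) {x y : ℂ} (h : x ≠ 0 ∨ y ≠ 0) :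
    A 0 0 * x + A 0 1 * y ≠ 0 ∨ A 1 0 * x + A 1 1 * y ≠ 0 := by
  by_contra! hc
  obtain ⟨h1, h2⟩ := hc
  have hd := sl_det A
  have hx : x = 0 := by linear_combination A 1 1 * h1 - A 0 1 * h2 - x * hd
  have hy : y = 0 := by linear_combination A 0 0 * h2 - A 1 0 * h1 - y * hd
  tauto

/-! ### Holomorphic self-maps of the sphere and their local orders. -/

/-- A self-map of `ℂ ∪ {∞}` is holomorphic at `p` if near `p` it is given in homogeneous
coordinates by analytic functions without common zero. -/
def HolAt (f : OnePoint ℂ → OnePoint ℂ) (p : OnePoint ℂ) : Prop :=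
  ∃ A B : ℂ → ℂ, AnalyticAt ℂ A 0 ∧ AnalyticAt ℂ B 0 ∧ (A 0 ≠ 0 ∨ B 0 ≠ 0) ∧
    ∀ᶠ z in 𝓝 (0 : ℂ), f (localParam p z) = ptOf (A z) (B z)

/-- The expression of `f` in the local coordinates at `p` and `f p`. -/
def chart (f : OnePoint ℂ → OnePoint ℂ) (p : OnePoint ℂ) (z : ℂ) : ℂ :=
  localCoord (f p) (f (localParam p z))

theorem mult_eq (u : RatFunc ℂ) (p : OnePoint ℂ) :
    mult u p = analyticOrderAt (chart (toMap u) p) 0 := rfl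

theorem localCoord_self (q : OnePoint ℂ) : localCoord q q = 0 := by
  cases q with
  | infty => simp [localCoord]
  | coe q => simp [localCoord]

@[simp]
theorem chart_zero (f : OnePoint ℂ → OnePoint ℂ) (p : OnePoint ℂ) : chart f p 0 = 0 := by
  rw [chart, localParam_zero, localCoord_self]

/-- The chart is `B / A` when `f p = ∞` and `A / B` minus its value at `0` otherwise. The second
conclusion, that `localParam` undoes `localCoord`, holds only near `p`, because `localCoord` has a
junk value at `∞` for a finite centre. -/
theorem HolAt.analyticAt_chart {f : OnePoint ℂ → OnePoint ℂ} {p : OnePoint ℂ} (h : HolAt f p) :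
    AnalyticAt ℂ (chart f p) 0 ∧
      ∀ᶠ z in 𝓝 (0 : ℂ), localParam (f p) (chart f p z) = f (localParam p z) := by
  obtain ⟨A, B, hA, hB, h0, hf⟩ := h
  have hfp : f p = ptOf (A 0) (B 0) := by simpa using hf.self_of_nhds
  by_cases hB0 : B 0 = 0
  · have hA0 : A 0 ≠ 0 := by tauto
    have hp : f p = OnePoint.infty := by rw [hfp, ptOf, if_pos hB0]
    have key : ∀ᶠ z in 𝓝 (0 : ℂ), chart f p z = B z / A z ∧
        localParam (f p) (B z / A z) = f (localParam p z) := by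
      filter_upwards [hf, hA.continuousAt.eventually_ne hA0] with z hz hAz
      rw [chart, hp, hz]
      by_cases hBz : B z = 0
      · simp [ptOf, hBz, localCoord, localParam]
      · simp [ptOf, hBz, localCoord, localParam, hAz]
    refine ⟨(hB.div hA hA0).congr ?_, ?_⟩
    · filter_upwards [key] with z hz using hz.1.symm
    · filter_upwards [key] with z hz
      rw [hz.1, hz.2]
  · have hp : f p = ((A 0 / B 0 : ℂ) : OnePoint ℂ) := by rw [hfp, ptOf, if_neg hB0]
    have key : ∀ᶠ z in 𝓝 (0 : ℂ), chart f p z = A z / B z - A 0 / B 0 ∧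
        localParam (f p) (A z / B z - A 0 / B 0) = f (localParam p z) := by
      filter_upwards [hf, hB.continuousAt.eventually_ne hB0] with z hz hBz
      rw [chart, hp, hz]
      simp [ptOf, hBz, localCoord, localParam]
    refine ⟨((hA.div hB hB0).sub (analyticAt_const (v := A 0 / B 0))).congr ?_, ?_⟩
    · filter_upwards [key] with z hz using hz.1.symm
    · filter_upwards [key] with z hz
      rw [hz.1, hz.2]

theorem HolAt.tendsto_chart {f : OnePoint ℂ → OnePoint ℂ} {p : OnePoint ℂ} (h : HolAt f p) :
    Tendsto (chart f p) (𝓝 0) (𝓝 0) := by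
  simpa [ContinuousAt] using h.analyticAt_chart.1.continuousAt

theorem HolAt.comp {f g : OnePoint ℂ → OnePoint ℂ} {p : OnePoint ℂ} (hg : HolAt g (f p))
    (hf : HolAt f p) : HolAt (g ∘ f) p := by
  obtain ⟨A, B, hA, hB, h0, hgz⟩ := hg
  have hc := hf.analyticAt_chart
  refine ⟨A ∘ chart f p, B ∘ chart f p, AnalyticAt.comp (by simpa using hA) hc.1,
    AnalyticAt.comp (by simpa using hB) hc.1, by simpa using h0, ?_⟩
  filter_upwards [hc.2, hf.tendsto_chart.eventually hgz] with z h1 h2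
  rw [Function.comp_apply, ← h1, h2]
  rfl

theorem HolAt.order_chart_comp {f g : OnePoint ℂ → OnePoint ℂ} {p : OnePoint ℂ}
    (hg : HolAt g (f p)) (hf : HolAt f p) :
    analyticOrderAt (chart (g ∘ f) p) 0 =
      analyticOrderAt (chart g (f p)) 0 * analyticOrderAt (chart f p) 0 := by
  have hc := hf.analyticAt_chart
  have h1 : chart (g ∘ f) p =ᶠ[𝓝 0] chart g (f p) ∘ chart f p := by
    filter_upwards [hc.2] with z hz
    simp only [chart, Function.comp_apply] at hz ⊢
    rw [hz]
  rw [analyticOrderAt_congr h1, AnalyticAt.analyticOrderAt_comp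
    (by simpa using hg.analyticAt_chart.1) hc.1]
  simp

theorem HolAt.order_chart_ne_zero {f : OnePoint ℂ → OnePoint ℂ} {p : OnePoint ℂ}
    (h : HolAt f p) : analyticOrderAt (chart f p) 0 ≠ 0 :=
  h.analyticAt_chart.1.analyticOrderAt_ne_zero.mpr (chart_zero f p)

/-- Holomorphic maps which agree outside a finite set are equal. -/
theorem HolAt.eq_of_finite {f g : OnePoint ℂ → OnePoint ℂ} (hf : ∀ p, HolAt f p)
    (hg : ∀ p, HolAt g p) {S : Set (OnePoint ℂ)} (hS : S.Finite) (h : ∀ p ∉ S, f p = g p) :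
    f = g := by
  funext p
  obtain ⟨A, B, hA, hB, h0, hfz⟩ := hf p
  obtain ⟨A', B', hA', hB', h0', hgz⟩ := hg p
  have e1 : f p = ptOf (A 0) (B 0) := by simpa using hfz.self_of_nhds
  have e2 : g p = ptOf (A' 0) (B' 0) := by simpa using hgz.self_of_nhds
  have nz : ∀ {A B : ℂ → ℂ}, AnalyticAt ℂ A 0 → AnalyticAt ℂ B 0 → (A 0 ≠ 0 ∨ B 0 ≠ 0) →
      ∀ᶠ z in 𝓝 (0 : ℂ), A z ≠ 0 ∨ B z ≠ 0 := by
    intro A B hA hB h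
    rcases h with h | h
    · exact (hA.continuousAt.eventually_ne h).mono fun _ => Or.inl
    · exact (hB.continuousAt.eventually_ne h).mono fun _ => Or.inr
  have key : ∀ᶠ z in 𝓝[≠] (0 : ℂ), A z * B' z = A' z * B z := by
    filter_upwards [eventually_localParam_notMem p hS, nhdsWithin_le_nhds hfz,
      nhdsWithin_le_nhds hgz, nhdsWithin_le_nhds (nz hA hB h0),
      nhdsWithin_le_nhds (nz hA' hB' h0')] with z h1 h2 h3 h4 h5
    rw [← ptOf_eq_iff h4 h5, ← h2, ← h3, h _ h1]
  rw [e1, e2, ptOf_eq_iff h0 h0']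
  have l1 : Tendsto (fun z => A z * B' z) (𝓝[≠] 0) (𝓝 (A 0 * B' 0)) :=
    (hA.continuousAt.mul hB'.continuousAt).tendsto.mono_left nhdsWithin_le_nhds
  have l2 : Tendsto (fun z => A' z * B z) (𝓝[≠] 0) (𝓝 (A' 0 * B 0)) :=
    (hA'.continuousAt.mul hB.continuousAt).tendsto.mono_left nhdsWithin_le_nhds
  exact tendsto_nhds_unique_of_eventuallyEq l1 l2 key

theorem analyticAt_eval (P : Polynomial ℂ) (z : ℂ) : AnalyticAt ℂ (fun z => P.eval z) z := by
  simpa using! AnalyticAt.aeval_polynomial (analyticAt_id (𝕜 := ℂ) (z := z)) P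

theorem holAt_toMap (u : RatFunc ℂ) (p : OnePoint ℂ) : HolAt (toMap u) p := by
  cases p with
  | coe p =>
    have hc : AnalyticAt ℂ (fun z : ℂ => p + z) 0 := analyticAt_const.add analyticAt_id
    refine ⟨fun z => u.num.eval (p + z), fun z => u.denom.eval (p + z),
      (analyticAt_eval u.num (p + 0)).comp hc, (analyticAt_eval u.denom (p + 0)).comp hc, ?_,
      Eventually.of_forall fun z => rfl⟩
    obtain ⟨a, b, hab⟩ := RatFunc.isCoprime_num_denom u
    by_contra! hcon
    have := congrArg (Polynomial.eval (p + 0)) hab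
    rw [Polynomial.eval_add, Polynomial.eval_mul, Polynomial.eval_mul, hcon.1, hcon.2] at this
    simp at this
  | infty =>
    -- At `∞` the homogeneous coordinates are the reflected polynomials `z ^ d * P(1/z)`; at least
    -- one has nonzero constant term, since `d` is the larger degree.
    set d := max u.num.natDegree u.denom.natDegree with hd
    have hrefl : ∀ P : Polynomial ℂ, (P.reflect d).eval 0 = P.coeff d := by
      intro P
      rw [← Polynomial.coeff_zero_eq_eval_zero, Polynomial.coeff_reflect,
        Polynomial.revAt_le (Nat.zero_le d), Nat.sub_zero]
    refine ⟨fun z => (u.num.reflect d).eval z, fun z => (u.denom.reflect d).eval z,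
      analyticAt_eval _ 0, analyticAt_eval _ 0, ?_, Eventually.of_forall fun z => ?_⟩
    · simp only [hrefl]
      rcases max_choice u.num.natDegree u.denom.natDegree with h | h
      · by_cases hn : u.num = 0
        · right
          have hu : u = 0 := RatFunc.num_eq_zero_iff.mp hn
          have hd1 : u.denom = 1 := by rw [hu, RatFunc.denom_zero]
          have : d = 0 := by rw [hd, hn, hd1]; simp
          simp [this, hd1]
        · left
          rw [hd, h]
          simpa using hn
      · right
        rw [hd, h]
        simpa using u.denom_ne_zero
    · by_cases hz : z = 0
      · subst hz
        simp only [hrefl, localParam_zero]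
        rfl
      · have key : ∀ P : Polynomial ℂ, P.natDegree ≤ d →
            (P.reflect d).eval z = z ^ d * P.eval z⁻¹ := by
          intro P hP
          let _ : Invertible z⁻¹ := invertibleOfNonzero (inv_ne_zero hz)
          have := Polynomial.eval₂_reflect_mul_pow (RingHom.id ℂ) z⁻¹ d P hP
          rw [invOf_eq_inv, inv_inv] at this
          change (P.reflect d).eval z * _ = P.eval z⁻¹ at this
          rw [← this, mul_left_comm, ← mul_pow, mul_inv_cancel₀ hz, one_pow, mul_one]
        simp only [localParam, hz, if_false]
        rw [key _ (le_max_left _ _), key _ (le_max_right _ _), ptOf_mul (pow_ne_zero d hz)]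
        rfl

/-! ### Values of rational functions and composition. -/

/-- `x` is regular at `z` with value `c`. -/
def RegularAt (z : ℂ) (x : RatFunc ℂ) (c : ℂ) : Prop :=
  ∃ P Q : Polynomial ℂ, Q.eval z ≠ 0 ∧
    x = algebraMap (Polynomial ℂ) (RatFunc ℂ) P / algebraMap (Polynomial ℂ) (RatFunc ℂ) Q ∧
    c = P.eval z / Q.eval z

theorem algebraMap_ne_zero_of_eval {Q : Polynomial ℂ} {z : ℂ} (h : Q.eval z ≠ 0) :
    algebraMap (Polynomial ℂ) (RatFunc ℂ) Q ≠ 0 := by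
  intro h0
  rw [map_eq_zero_iff _ (RatFunc.algebraMap_injective ℂ)] at h0
  simp [h0] at h

theorem RegularAt.add {z c d : ℂ} {x y : RatFunc ℂ} (hx : RegularAt z x c)
    (hy : RegularAt z y d) : RegularAt z (x + y) (c + d) := by
  obtain ⟨P, Q, hQ, rfl, rfl⟩ := hx
  obtain ⟨P', Q', hQ', rfl, rfl⟩ := hy
  refine ⟨P * Q' + Q * P', Q * Q', by simp [hQ, hQ'], ?_, ?_⟩
  · rw [div_add_div _ _ (algebraMap_ne_zero_of_eval hQ) (algebraMap_ne_zero_of_eval hQ')]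
    simp
  · rw [div_add_div _ _ hQ hQ']
    simp

theorem RegularAt.mul {z c d : ℂ} {x y : RatFunc ℂ} (hx : RegularAt z x c)
    (hy : RegularAt z y d) : RegularAt z (x * y) (c * d) := by
  obtain ⟨P, Q, hQ, rfl, rfl⟩ := hx
  obtain ⟨P', Q', hQ', rfl, rfl⟩ := hy
  refine ⟨P * P', Q * Q', by simp [hQ, hQ'], ?_, ?_⟩
  · rw [div_mul_div_comm]
    simp
  · rw [div_mul_div_comm]
    simp

theorem RegularAt.div {z c d : ℂ} {x y : RatFunc ℂ} (hx : RegularAt z x c)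
    (hy : RegularAt z y d) (hd : d ≠ 0) : RegularAt z (x / y) (c / d) := by
  obtain ⟨P, Q, hQ, rfl, rfl⟩ := hx
  obtain ⟨P', Q', hQ', rfl, rfl⟩ := hy
  have hP' : P'.eval z ≠ 0 := fun h => hd (by rw [h, zero_div])
  refine ⟨P * Q', Q * P', by simp [hQ, hP'], ?_, ?_⟩
  · rw [div_div_div_eq]
    simp
  · rw [div_div_div_eq]
    simp

theorem regularAt_C (z c : ℂ) : RegularAt z (algebraMap ℂ (RatFunc ℂ) c) c :=
  ⟨Polynomial.C c, 1, by simp, by simp, by simp⟩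

theorem RegularAt.pow {z c : ℂ} {x : RatFunc ℂ} (hx : RegularAt z x c) (n : ℕ) :
    RegularAt z (x ^ n) (c ^ n) := by
  induction n with
  | zero => simpa using regularAt_C z 1
  | succ n ih =>
    rw [pow_succ, pow_succ]
    exact ih.mul hx

theorem RegularAt.aeval {z c : ℂ} {x : RatFunc ℂ} (hx : RegularAt z x c) (r : Polynomial ℂ) :
    RegularAt z (Polynomial.aeval x r) (r.eval c) := by
  induction r using Polynomial.induction_on' with
  | add p q hp hq =>
    rw [map_add, Polynomial.eval_add]
    exact hp.add hq
  | monomial n a =>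
    rw [Polynomial.aeval_monomial, Polynomial.eval_monomial]
    exact (regularAt_C z a).mul (hx.pow n)

/-- Any fraction whose denominator does not vanish at `z` computes the value of the reduced
fraction, so `toMap` can be evaluated without reducing to lowest terms. -/
theorem RegularAt.denom_eval_ne_zero {z c : ℂ} {x : RatFunc ℂ} (hx : RegularAt z x c) :
    x.denom.eval z ≠ 0 ∧ c = x.num.eval z / x.denom.eval z := by
  obtain ⟨P, Q, hQ, h, rfl⟩ := hx
  have hQ0 : Q ≠ 0 := by
    rintro rfl
    simp at hQ
  have hd : x.denom.eval z ≠ 0 := by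
    obtain ⟨D, hD⟩ : x.denom ∣ Q := by
      rw [h]
      exact RatFunc.denom_div_dvd P Q
    intro h0
    rw [hD, Polynomial.eval_mul, h0, zero_mul] at hQ
    exact hQ rfl
  refine ⟨hd, ?_⟩
  have h1 := RatFunc.num_div_denom x
  rw [h, div_eq_div_iff _ (algebraMap_ne_zero_of_eval hQ), ← h, ← map_mul, ← map_mul] at h1
  · have h2 := congrArg (Polynomial.eval z) (RatFunc.algebraMap_injective ℂ h1)
    rw [Polynomial.eval_mul, Polynomial.eval_mul] at h2
    rw [div_eq_div_iff hQ hd, h2]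
  · rw [← h]
    exact algebraMap_ne_zero_of_eval hd

theorem RegularAt.toMap_eq {z c : ℂ} {x : RatFunc ℂ} (hx : RegularAt z x c) :
    toMap x (z : OnePoint ℂ) = (c : OnePoint ℂ) := by
  obtain ⟨h1, rfl⟩ := hx.denom_eval_ne_zero
  exact if_neg h1

theorem regularAt_of_denom {z : ℂ} {x : RatFunc ℂ} (h : x.denom.eval z ≠ 0) :
    RegularAt z x (x.num.eval z / x.denom.eval z) :=
  ⟨x.num, x.denom, h, (RatFunc.num_div_denom x).symm, rfl⟩

theorem finite_eval_eq_zero {P : Polynomial ℂ} (hP : P ≠ 0) : {z : ℂ | P.eval z = 0}.Finite :=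
  (P.roots.toFinset.finite_toSet).subset fun z hz => by simpa [hP] using hz

/-- An element of `ℂ(u)` factors through `u` as a map. -/
theorem exists_toMap_comp {u v : RatFunc ℂ} (hv : v ∈ IntermediateField.adjoin ℂ {u}) :
    ∃ R : RatFunc ℂ, toMap v = toMap R ∘ toMap u := by
  obtain ⟨r, s, h, hs⟩ : ∃ r s : Polynomial ℂ,
      v = Polynomial.aeval u r / Polynomial.aeval u s ∧ Polynomial.aeval u s ≠ 0 := by
    obtain ⟨r, s, h⟩ := (IntermediateField.mem_adjoin_simple_iff ℂ v).mp hv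
    -- If `s(u) = 0`, division by zero makes `v = 0`, which is rewritten as `0 / 1` to have a
    -- genuine denominator.
    by_cases hs : Polynomial.aeval u s = 0
    · exact ⟨0, 1, by simp [h, hs], by simp⟩
    · exact ⟨r, s, h, hs⟩
  refine ⟨algebraMap (Polynomial ℂ) (RatFunc ℂ) r / algebraMap (Polynomial ℂ) (RatFunc ℂ) s, ?_⟩
  refine HolAt.eq_of_finite (holAt_toMap v) (fun p => (holAt_toMap _ _).comp (holAt_toMap u p))
    (S := {OnePoint.infty} ∪ (fun z : ℂ => (z : OnePoint ℂ)) '' ({z | u.denom.eval z = 0} ∪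
      {z | (Polynomial.aeval u s).num.eval z = 0})) ?_ ?_
  · exact (Set.finite_singleton _).union (((finite_eval_eq_zero u.denom_ne_zero).union
      (finite_eval_eq_zero (RatFunc.num_ne_zero hs))).image _)
  · intro p hp
    cases p with
    | infty => simp at hp
    | coe z =>
      have hp' : u.denom.eval z ≠ 0 ∧ (Polynomial.aeval u s).num.eval z ≠ 0 := by
        constructor
        · exact fun h0 => hp (Or.inr ⟨z, Or.inl h0, rfl⟩)
        · exact fun h0 => hp (Or.inr ⟨z, Or.inr h0, rfl⟩)
      have hu := regularAt_of_denom hp'.1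
      have hs' := hu.aeval s
      have hsc : s.eval (u.num.eval z / u.denom.eval z) ≠ 0 := by
        rw [hs'.denom_eval_ne_zero.2]
        exact div_ne_zero hp'.2 hs'.denom_eval_ne_zero.1
      have hvz := (hu.aeval r).div hs' hsc
      rw [← h] at hvz
      rw [hvz.toMap_eq, Function.comp_apply, hu.toMap_eq]
      exact (RegularAt.toMap_eq ⟨r, s, hsc, rfl, rfl⟩).symm

/-! ### Lifts to `SL(2, ℂ)` and forms vanishing along an orbit. -/

theorem exists_smul_of_coe_eq {A B : SL(2, ℂ)} (h : (A : PSL(2, ℂ)) = B) :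
    ∃ ε : ℂ, ε ^ 2 = 1 ∧ ∀ i j, A i j = ε * B i j := by
  have h1 : B⁻¹ * A ∈ Subgroup.center SL(2, ℂ) := QuotientGroup.eq.mp h.symm
  obtain ⟨ε, h2, h3⟩ := Matrix.SpecialLinearGroup.mem_center_iff.mp h1
  refine ⟨ε, by simpa using h2, fun i j => ?_⟩
  have h4 : A.1 = B.1 * (B⁻¹ * A).1 := by
    rw [← Matrix.SpecialLinearGroup.coe_mul, mul_inv_cancel_left]
  change A.1 i j = ε * B.1 i j
  rw [h4, ← h3]
  simp [mul_comm]

/-- A representative in `SL(2, ℂ)` of an element of `PSL(2, ℂ)`. -/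
def lift (g : PSL(2, ℂ)) : SL(2, ℂ) := Quotient.out g

@[simp]
theorem coe_lift (g : PSL(2, ℂ)) : ((lift g : SL(2, ℂ)) : PSL(2, ℂ)) = g :=
  QuotientGroup.out_eq' g

/-- The first coordinate of the representative of `g` applied to the vector representing `a`. -/
def movX (g : PSL(2, ℂ)) (a : OnePoint ℂ) : ℂ :=
  lift g 0 0 * coordX a 0 + lift g 0 1 * coordY a 0

/-- The second coordinate of the representative of `g` applied to the vector representing `a`. -/
def movY (g : PSL(2, ℂ)) (a : OnePoint ℂ) : ℂ :=
  lift g 1 0 * coordX a 0 + lift g 1 1 * coordY a 0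

theorem mov_ne_zero (g : PSL(2, ℂ)) (a : OnePoint ℂ) : movX g a ≠ 0 ∨ movY g a ≠ 0 :=
  sl_apply_ne_zero (lift g) (coord_ne_zero a 0)

theorem ptOf_mov (g : PSL(2, ℂ)) (a : OnePoint ℂ) : ptOf (movX g a) (movY g a) = g • a := by
  rw [movX, movY, ← sl_smul_ptOf (lift g) (coord_ne_zero a 0), coe_lift, ptOf_coord]

/-- The binary form vanishing along the orbit of `a`. -/
def orbitForm (G : Subgroup PSL(2, ℂ)) [Fintype G] (a : OnePoint ℂ) (x y : ℂ) : ℂ :=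
  ∏ g : G, (x * movY g a - y * movX g a)

theorem factor_eq_zero_iff (g : PSL(2, ℂ)) (a : OnePoint ℂ) {x y : ℂ} (h : x ≠ 0 ∨ y ≠ 0) :
    x * movY g a - y * movX g a = 0 ↔ g • a = ptOf x y := by
  rw [← ptOf_mov, ptOf_eq_iff (mov_ne_zero g a) h, sub_eq_zero, mul_comm y, eq_comm]

section

variable (G : Subgroup PSL(2, ℂ)) [Fintype G]

theorem orbitForm_eq_zero_iff (a : OnePoint ℂ) {x y : ℂ} (h : x ≠ 0 ∨ y ≠ 0) :
    orbitForm G a x y = 0 ↔ ∃ g ∈ G, g • a = ptOf x y := by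
  simp [orbitForm, Finset.prod_eq_zero_iff, factor_eq_zero_iff _ a h]

/-- Left translation by `h` permutes the factors. Each factor is a determinant, preserved by `SL(2,
ℂ)` up to the sign relating the chosen lift of `h * g` to the product of lifts. The total sign does
not depend on `a`, so it cancels in quotients of two orbit forms. -/
theorem orbitForm_smul {h : PSL(2, ℂ)} (hh : h ∈ G) :
    ∃ ε : ℂ, ε ≠ 0 ∧ ∀ (a : OnePoint ℂ) (x y : ℂ),
      orbitForm G a (lift h 0 0 * x + lift h 0 1 * y) (lift h 1 0 * x + lift h 1 1 * y) =
        ε * orbitForm G a x y := by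
  have key : ∀ g : PSL(2, ℂ), ∃ ε : ℂ, ε ^ 2 = 1 ∧
      ∀ i j, lift (h * g) i j = ε * (lift h * lift g) i j := fun g =>
    exists_smul_of_coe_eq (by simp [QuotientGroup.mk_mul])
  choose ε hε1 hε2 using key
  refine ⟨∏ g : G, ε g, Finset.prod_ne_zero_iff.mpr fun g _ h0 => ?_, fun a x y => ?_⟩
  · have := hε1 g
    simp [h0] at this
  · unfold orbitForm
    rw [← Equiv.prod_comp (Equiv.mulLeft (⟨h, hh⟩ : G)), ← Finset.prod_mul_distrib]
    refine Finset.prod_congr rfl fun g _ => ?_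
    have hd := sl_det (lift h)
    simp only [Equiv.coe_mulLeft, Subgroup.coe_mul, movX, movY, hε2,
      Matrix.SpecialLinearGroup.coe_mul, Matrix.mul_apply, Fin.sum_univ_two]
    linear_combination ε g * (x * (lift g 1 0 * coordX a 0 + lift g 1 1 * coordY a 0) -
      y * (lift g 0 0 * coordX a 0 + lift g 0 1 * coordY a 0)) * hd

/-- The numerator of the invariant function associated with the orbit of `a`. -/
def orbitPoly (a : OnePoint ℂ) : Polynomial ℂ :=
  ∏ g : G, (Polynomial.X * Polynomial.C (movY g a) - Polynomial.C (movX g a))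

theorem orbitPoly_eval (a : OnePoint ℂ) (z : ℂ) : (orbitPoly G a).eval z = orbitForm G a z 1 := by
  simp [orbitPoly, orbitForm, Polynomial.eval_prod, mul_comm z]

/-- The rational function with zeros along the orbit of `a` and poles along the orbit of `b`. -/
def orbitRat (a b : OnePoint ℂ) : RatFunc ℂ :=
  algebraMap (Polynomial ℂ) (RatFunc ℂ) (orbitPoly G a) /
    algebraMap (Polynomial ℂ) (RatFunc ℂ) (orbitPoly G b)

theorem analyticAt_orbitForm (a p : OnePoint ℂ) (z : ℂ) :
    AnalyticAt ℂ (fun z => orbitForm G a (coordX p z) (coordY p z)) z := by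
  have hX := analyticAt_coordX p z
  have hY := analyticAt_coordY p z
  unfold orbitForm
  fun_prop

theorem orbitForm_ne_zero {a b : OnePoint ℂ} (hab : ∀ g ∈ G, g • a ≠ b) {x y : ℂ}
    (h : x ≠ 0 ∨ y ≠ 0) : orbitForm G a x y ≠ 0 ∨ orbitForm G b x y ≠ 0 := by
  by_contra! hc
  obtain ⟨g, hg, h1⟩ := (orbitForm_eq_zero_iff G a h).mp hc.1
  obtain ⟨g', hg', h2⟩ := (orbitForm_eq_zero_iff G b h).mp hc.2
  exact hab (g'⁻¹ * g) (G.mul_mem (G.inv_mem hg') hg) (by rw [mul_smul, h1, ← h2, inv_smul_smul])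

theorem exists_coord_eq {x y : ℂ} (h : x ≠ 0 ∨ y ≠ 0) :
    ∃ c : ℂ, c ≠ 0 ∧ x = c * coordX (ptOf x y) 0 ∧ y = c * coordY (ptOf x y) 0 := by
  by_cases hy : y = 0
  · have hx : x ≠ 0 := by tauto
    exact ⟨x, hx, by simp [ptOf, hy, coordX], by simp [ptOf, hy, coordY]⟩
  · exact ⟨y, hy, by simp [ptOf, hy, coordX, mul_div_cancel₀], by simp [ptOf, hy, coordY]⟩

theorem orbitForm_mul (a : OnePoint ℂ) (c x y : ℂ) :
    orbitForm G a (c * x) (c * y) = c ^ Fintype.card G * orbitForm G a x y := by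
  unfold orbitForm
  rw [← Finset.card_univ, ← Finset.prod_const, ← Finset.prod_mul_distrib]
  exact Finset.prod_congr rfl fun g _ => by ring

theorem orbitPoly_ne_zero (a : OnePoint ℂ) : orbitPoly G a ≠ 0 := by
  refine Finset.prod_ne_zero_iff.mpr fun g _ h0 => ?_
  have h1 := congrArg (Polynomial.eval 0) h0
  have h2 := congrArg (Polynomial.eval 1) h0
  have h3 : movX g a = 0 := by simpa using h1
  have h4 : movY g a = 0 := by simpa [h3] using h2
  have := mov_ne_zero g a
  tauto

/-- The right side is well defined and holomorphic because the two forms have no common zero and the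
same degree. It agrees with the left side off `∞` and the zeros of the denominator, hence
everywhere. -/
theorem toMap_orbitRat {a b : OnePoint ℂ} (hab : ∀ g ∈ G, g • a ≠ b) {x y : ℂ}
    (h : x ≠ 0 ∨ y ≠ 0) :
    toMap (orbitRat G a b) (ptOf x y) = ptOf (orbitForm G a x y) (orbitForm G b x y) := by
  let f : OnePoint ℂ → OnePoint ℂ := fun p =>
    ptOf (orbitForm G a (coordX p 0) (coordY p 0)) (orbitForm G b (coordX p 0) (coordY p 0))
  have hf : ∀ {x y : ℂ}, x ≠ 0 ∨ y ≠ 0 →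
      f (ptOf x y) = ptOf (orbitForm G a x y) (orbitForm G b x y) := by
    intro x y h
    obtain ⟨c, hc, h1, h2⟩ := exists_coord_eq h
    have h3 : ∀ a, orbitForm G a x y = c ^ Fintype.card G *
        orbitForm G a (coordX (ptOf x y) 0) (coordY (ptOf x y) 0) := by
      intro a
      rw [← orbitForm_mul, ← h1, ← h2]
    rw [h3, h3, ptOf_mul (pow_ne_zero _ hc)]
  rw [← hf h]
  refine congrFun (HolAt.eq_of_finite (holAt_toMap _) (fun p => ?_)
    (S := {OnePoint.infty} ∪ (fun z : ℂ => (z : OnePoint ℂ)) '' {z | (orbitPoly G b).eval z = 0})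
    ?_ fun p hp => ?_) (ptOf x y)
  · refine ⟨fun z => orbitForm G a (coordX p z) (coordY p z),
      fun z => orbitForm G b (coordX p z) (coordY p z), analyticAt_orbitForm G a p 0,
      analyticAt_orbitForm G b p 0, orbitForm_ne_zero G hab (coord_ne_zero p 0),
      Eventually.of_forall fun z => ?_⟩
    rw [localParam_eq_ptOf, hf (coord_ne_zero p z)]
  · exact (Set.finite_singleton _).union ((finite_eval_eq_zero (orbitPoly_ne_zero G b)).image _)
  · cases p with
    | infty => simp at hp
    | coe z =>
      have hz : (orbitPoly G b).eval z ≠ 0 := fun h0 => hp (Or.inr ⟨z, h0, rfl⟩)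
      have h1 : RegularAt z (orbitRat G a b) _ := ⟨_, _, hz, rfl, rfl⟩
      have h2 : ((z : ℂ) : OnePoint ℂ) = ptOf z 1 := by simp [ptOf]
      rw [h1.toMap_eq, h2, hf (Or.inr one_ne_zero), orbitPoly_eval, orbitPoly_eval]
      rw [orbitPoly_eval] at hz
      simp [ptOf, hz]

theorem orbitRat_mem_invariants {a b : OnePoint ℂ} (hab : ∀ g ∈ G, g • a ≠ b) :
    orbitRat G a b ∈ invariants G := by
  intro g hg p
  obtain ⟨ε, hε, h⟩ := orbitForm_smul G hg
  have h1 : g • p = ptOf (lift g 0 0 * coordX p 0 + lift g 0 1 * coordY p 0)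
      (lift g 1 0 * coordX p 0 + lift g 1 1 * coordY p 0) := by
    rw [← sl_smul_ptOf (lift g) (coord_ne_zero p 0), coe_lift, ptOf_coord]
  rw [h1, toMap_orbitRat G hab (sl_apply_ne_zero _ (coord_ne_zero p 0)), h, h, ptOf_mul hε,
    ← toMap_orbitRat G hab (coord_ne_zero p 0), ptOf_coord]

theorem orbitForm_coord_self (a : OnePoint ℂ) : orbitForm G a (coordX a 0) (coordY a 0) = 0 := by
  rw [orbitForm_eq_zero_iff G a (coord_ne_zero a 0)]
  exact ⟨1, G.one_mem, by rw [one_smul, ptOf_coord]⟩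

theorem orbitForm_coord_ne_zero {a b : OnePoint ℂ} (hab : ∀ g ∈ G, g • a ≠ b) :
    orbitForm G b (coordX a 0) (coordY a 0) ≠ 0 := by
  have h := orbitForm_ne_zero G hab (coord_ne_zero a 0)
  rw [orbitForm_coord_self] at h
  tauto

theorem toMap_orbitRat_left {a b : OnePoint ℂ} (hab : ∀ g ∈ G, g • a ≠ b) :
    toMap (orbitRat G a b) a = ((0 : ℂ) : OnePoint ℂ) := by
  have h := toMap_orbitRat G hab (coord_ne_zero a 0)
  rwa [ptOf_coord, orbitForm_coord_self, ptOf, if_neg (orbitForm_coord_ne_zero G hab),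
    zero_div] at h

theorem toMap_orbitRat_right {a b : OnePoint ℂ} (hab : ∀ g ∈ G, g • a ≠ b) :
    toMap (orbitRat G a b) b = OnePoint.infty := by
  have h := toMap_orbitRat G hab (coord_ne_zero b 0)
  rwa [ptOf_coord, orbitForm_coord_self, ptOf, if_pos rfl] at h

theorem analyticOrderAt_finset_prod {ι : Type*} (s : Finset ι) (f : ι → ℂ → ℂ) (z : ℂ)
    (hf : ∀ i ∈ s, AnalyticAt ℂ (f i) z) :
    analyticOrderAt (fun w => ∏ i ∈ s, f i w) z = ∑ i ∈ s, analyticOrderAt (f i) z := by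
  classical
  induction s using Finset.induction_on with
  | empty =>
    simp only [Finset.prod_empty, Finset.sum_empty]
    exact analyticAt_const.analyticOrderAt_eq_zero.mpr one_ne_zero
  | insert i s hi ih =>
    simp only [Finset.prod_insert hi, Finset.sum_insert hi]
    have h1 : ∀ j ∈ s, AnalyticAt ℂ (f j) z := fun j hj => hf j (Finset.mem_insert_of_mem hj)
    rw [← ih h1]
    exact analyticOrderAt_mul (hf i (Finset.mem_insert_self i s))
      (Finset.analyticAt_fun_prod s h1)

/-- The factor is affine in `z` and vanishes at `0` exactly when `g` fixes `a`. In that case its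
slope is nonzero, as otherwise both coordinates of `g • a` would vanish. -/
theorem analyticOrderAt_factor_le (g : PSL(2, ℂ)) (a : OnePoint ℂ) [Decidable (g • a = a)] :
    analyticOrderAt (fun z => coordX a z * movY g a - coordY a z * movX g a) 0 ≤
      if g • a = a then 1 else 0 := by
  have hX := analyticAt_coordX a 0
  have hY := analyticAt_coordY a 0
  have hA : AnalyticAt ℂ (fun z => coordX a z * movY g a - coordY a z * movX g a) 0 := by fun_prop
  have h0 := factor_eq_zero_iff g a (coord_ne_zero a 0)
  rw [ptOf_coord] at h0
  split_ifs with h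
  · have hd : deriv (fun z => coordX a z * movY g a - coordY a z * movX g a) 0 ≠ 0 := by
      have h1 := h0.mpr h
      have h2 := mov_ne_zero g a
      cases a with
      | infty =>
        simp only [coordX, coordY] at h1 ⊢
        have h3 : movX g OnePoint.infty ≠ 0 := by
          intro h3
          simp [h3] at h1
          tauto
        simpa using h3
      | coe a =>
        simp only [coordX, coordY] at h1 ⊢
        have h3 : movY g (a : OnePoint ℂ) ≠ 0 := by
          intro h3
          simp [h3] at h1
          tauto
        simpa using h3
    exact (hA.analyticOrderAt_eq_one_of_zero_deriv_ne_zero (h0.mpr h) hd).le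
  · exact (hA.analyticOrderAt_eq_zero.mpr (h0.not.mpr h)).le

/-- The denominator does not vanish at `a`, so the order is that of the numerator, to which only the
factors indexed by the stabilizer contribute. -/
theorem mult_orbitRat_le {a b : OnePoint ℂ} (hab : ∀ g ∈ G, g • a ≠ b) :
    mult (orbitRat G a b) a ≤ (Nat.card (MulAction.stabilizer G a) : ℕ∞) := by
  classical
  have hXA := analyticAt_orbitForm G a a 0
  have hXB := analyticAt_orbitForm G b a 0
  have hB0 := orbitForm_coord_ne_zero G hab
  have h1 : chart (toMap (orbitRat G a b)) a =ᶠ[𝓝 0]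
      (fun z => orbitForm G a (coordX a z) (coordY a z)) *
        (fun z => orbitForm G b (coordX a z) (coordY a z))⁻¹ := by
    filter_upwards [hXB.continuousAt.eventually_ne hB0] with z hz
    rw [chart, toMap_orbitRat_left G hab, localParam_eq_ptOf,
      toMap_orbitRat G hab (coord_ne_zero a z), ptOf, if_neg hz]
    simp [localCoord, div_eq_mul_inv]
  have h2 : analyticOrderAt (fun z => orbitForm G b (coordX a z) (coordY a z))⁻¹ 0 = 0 :=
    (hXB.inv hB0).analyticOrderAt_eq_zero.mpr (inv_ne_zero hB0)
  rw [mult_eq, analyticOrderAt_congr h1, analyticOrderAt_mul hXA (hXB.inv hB0), h2, add_zero]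
  unfold orbitForm
  rw [analyticOrderAt_finset_prod]
  · refine (Finset.sum_le_sum fun (g : G) _ => analyticOrderAt_factor_le (g : PSL(2, ℂ)) a).trans ?_
    rw [Finset.sum_boole]
    refine le_of_eq (congrArg _ ?_)
    rw [Nat.card_eq_fintype_card, Fintype.card_subtype]
    rfl
  · intro g _
    have hX := analyticAt_coordX a 0
    have hY := analyticAt_coordY a 0
    fun_prop

end

/-! ### Fibres of a generator and the upper bound for multiplicities. -/

section

variable {G : Subgroup PSL(2, ℂ)} {u : RatFunc ℂ}

theorem IsInvariantGenerator.toMap_smul (hu : IsInvariantGenerator G u) {g : PSL(2, ℂ)}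
    (hg : g ∈ G) (p : OnePoint ℂ) : toMap u (g • p) = toMap u p := by
  have h : u ∈ invariants G := by
    rw [← hu]
    exact IntermediateField.mem_adjoin_simple_self ℂ u
  exact h g hg p

theorem IsInvariantGenerator.exists_comp (hu : IsInvariantGenerator G u) {v : RatFunc ℂ}
    (hv : v ∈ invariants G) : ∃ R : RatFunc ℂ, toMap v = toMap R ∘ toMap u := by
  rw [← hu] at hv
  exact exists_toMap_comp hv

/-- The fibres of `u` are the orbits of `G`. -/
theorem IsInvariantGenerator.toMap_eq_iff [Finite G] (hu : IsInvariantGenerator G u)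
    {p q : OnePoint ℂ} : toMap u p = toMap u q ↔ ∃ g ∈ G, g • p = q := by
  have := Fintype.ofFinite G
  constructor
  · intro h
    -- The invariant `orbitRat G p q` factors through `u` but takes the values `0` at `p` and `∞` at
    -- `q`.
    by_contra! hc
    obtain ⟨R, hR⟩ := hu.exists_comp (orbitRat_mem_invariants G hc)
    have h1 := toMap_orbitRat_left G hc
    have h2 := toMap_orbitRat_right G hc
    rw [hR, Function.comp_apply] at h1 h2
    rw [h, h2] at h1
    simp at h1
  · rintro ⟨g, hg, rfl⟩
    exact (hu.toMap_smul hg p).symm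

theorem exists_notMem_orbit [Finite G] (p : OnePoint ℂ) : ∃ q, ∀ g ∈ G, g • p ≠ q := by
  have hfin : (Set.range fun g : G => (g : PSL(2, ℂ)) • p).Finite := Set.finite_range _
  have : Infinite (OnePoint ℂ) := Infinite.of_injective _ OnePoint.coe_injective
  obtain ⟨q, hq⟩ := hfin.infinite_compl.nonempty
  exact ⟨q, fun g hg h => hq ⟨⟨g, hg⟩, h⟩⟩

/-- Writing `orbitRat` as `R ∘ u`, its order at `p` is that of `u` times that of `R`, and the latter
is at least one. -/
theorem IsInvariantGenerator.mult_le [Finite G] (hu : IsInvariantGenerator G u)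
    (p : OnePoint ℂ) : mult u p ≤ (Nat.card (MulAction.stabilizer G p) : ℕ∞) := by
  have := Fintype.ofFinite G
  obtain ⟨q, hq⟩ := exists_notMem_orbit (G := G) p
  obtain ⟨R, hR⟩ := hu.exists_comp (orbitRat_mem_invariants G hq)
  refine le_trans ?_ (mult_orbitRat_le G hq)
  rw [mult_eq, mult_eq, hR, (holAt_toMap R _).order_chart_comp (holAt_toMap u p)]
  exact le_mul_of_one_le_left zero_le
    (Order.one_le_iff_ne_zero.mpr (holAt_toMap R _).order_chart_ne_zero)

theorem mult_ne_zero (u : RatFunc ℂ) (p : OnePoint ℂ) : mult u p ≠ 0 :=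
  (holAt_toMap u p).order_chart_ne_zero

end

/-! ### Eigenvalues and fixed points of Möbius transformations. -/

/-- The eigenvalue of `A` on the line `p`, if `A` fixes `p`. -/
def eigen (A : SL(2, ℂ)) : OnePoint ℂ → ℂ
  | OnePoint.some p => A 1 0 * p + A 1 1
  | OnePoint.infty => A 0 0

theorem smul_infty_eq_iff (A : SL(2, ℂ)) :
    (A : PSL(2, ℂ)) • (OnePoint.infty : OnePoint ℂ) = OnePoint.infty ↔ A 1 0 = 0 := by
  have h := sl_smul_ptOf A (x := 1) (y := 0) (by simp)
  have h1 : ptOf 1 0 = OnePoint.infty := by simp [ptOf]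
  rw [h1] at h
  rw [h, ptOf_eq_self_iff (sl_apply_ne_zero A (by simp))]
  simp [coordX, coordY, eq_comm]

theorem smul_coe_eq_iff (A : SL(2, ℂ)) (p : ℂ) :
    (A : PSL(2, ℂ)) • (p : OnePoint ℂ) = p ↔ A 0 0 * p + A 0 1 = p * (A 1 0 * p + A 1 1) := by
  have h := sl_smul_ptOf A (x := p) (y := 1) (by simp)
  have h1 : ptOf p 1 = (p : OnePoint ℂ) := by simp [ptOf]
  rw [h1] at h
  rw [h, ptOf_eq_self_iff (sl_apply_ne_zero A (by simp))]
  simp [coordX, coordY]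

theorem eigen_ne_zero {A : SL(2, ℂ)} {p : OnePoint ℂ} (hA : (A : PSL(2, ℂ)) • p = p) :
    eigen A p ≠ 0 := by
  have hd := sl_det A
  intro h0
  cases p with
  | infty =>
    rw [smul_infty_eq_iff] at hA
    simp only [eigen] at h0
    simp [h0, hA] at hd
  | coe p =>
    rw [smul_coe_eq_iff] at hA
    simp only [eigen] at h0
    rw [h0, mul_zero] at hA
    have h1 : A 0 0 * A 1 1 - A 0 1 * A 1 0 = 0 := by
      linear_combination A 0 0 * h0 - A 1 0 * hA
    rw [h1] at hd
    exact zero_ne_one hd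

theorem trace_mul_eigen {A : SL(2, ℂ)} {p : OnePoint ℂ} (hA : (A : PSL(2, ℂ)) • p = p) :
    (A 0 0 + A 1 1) * eigen A p = eigen A p ^ 2 + 1 := by
  have hd := sl_det A
  cases p with
  | infty =>
    rw [smul_infty_eq_iff] at hA
    simp only [eigen]
    linear_combination hd + A 0 1 * hA
  | coe p =>
    rw [smul_coe_eq_iff] at hA
    simp only [eigen]
    linear_combination hd + A 1 0 * hA

/-- The local form of a Möbius map at a fixed point: its multiplier there is the inverse square of
the eigenvalue. -/
theorem exists_smul_localParam {A : SL(2, ℂ)} {p : OnePoint ℂ} (hA : (A : PSL(2, ℂ)) • p = p) :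
    ∃ c : ℂ, ∀ z : ℂ, eigen A p + c * z ≠ 0 →
    (A : PSL(2, ℂ)) • localParam p z =
      localParam p ((eigen A p)⁻¹ * z / (eigen A p + c * z)) := by
  have hd := sl_det A
  have hμ := eigen_ne_zero hA
  have key : ∀ c : ℂ, (∀ z, (A 0 0 * coordX p z + A 0 1 * coordY p z) *
      coordY p ((eigen A p)⁻¹ * z / (eigen A p + c * z)) =
      coordX p ((eigen A p)⁻¹ * z / (eigen A p + c * z)) *
        (A 1 0 * coordX p z + A 1 1 * coordY p z) ∨ eigen A p + c * z = 0) →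
      ∀ z : ℂ, eigen A p + c * z ≠ 0 → (A : PSL(2, ℂ)) • localParam p z =
      localParam p ((eigen A p)⁻¹ * z / (eigen A p + c * z)) := by
    intro c h z hz
    rw [localParam_eq_ptOf, localParam_eq_ptOf, sl_smul_ptOf A (coord_ne_zero p z),
      ptOf_eq_iff (sl_apply_ne_zero A (coord_ne_zero p z)) (coord_ne_zero _ _)]
    exact (h z).resolve_right hz
  cases p with
  | infty =>
    rw [smul_infty_eq_iff] at hA
    refine ⟨A 0 1, key _ fun z => or_iff_not_imp_right.mpr fun hz => ?_⟩
    simp only [eigen, coordX, coordY] at hz hμ ⊢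
    have h1 : A 1 1 = (A 0 0)⁻¹ := by
      apply eq_inv_of_mul_eq_one_left
      linear_combination hd + A 0 1 * hA
    rw [hA, h1]
    field_simp
    ring
  | coe p =>
    rw [smul_coe_eq_iff] at hA
    refine ⟨A 1 0, key _ fun z => or_iff_not_imp_right.mpr fun hz => ?_⟩
    simp only [eigen, coordX, coordY] at hz hμ ⊢
    have h1 : A 0 0 = A 1 0 * p + (A 1 0 * p + A 1 1)⁻¹ := by
      rw [← sub_eq_iff_eq_add']
      apply eq_inv_of_mul_eq_one_left
      linear_combination hd + A 1 0 * hA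
    have h2 : A 0 1 = p * (A 1 0 * p + A 1 1) - A 0 0 * p := by linear_combination hA
    have h3 : A 1 0 * (p + z) + A 1 1 * 1 = A 1 0 * p + A 1 1 + A 1 0 * z := by ring
    rw [h3, add_mul (p : ℂ), div_mul_cancel₀ ((A 1 0 * p + A 1 1)⁻¹ * z) hz, h2, h1]
    ring

theorem eigen_mul {A B : SL(2, ℂ)} {p : OnePoint ℂ} (hB : (B : PSL(2, ℂ)) • p = p) :
    eigen (A * B) p = eigen A p * eigen B p := by
  cases p with
  | infty =>
    rw [smul_infty_eq_iff] at hB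
    simp [eigen, Matrix.mul_apply, Fin.sum_univ_two, hB]
  | coe p =>
    rw [smul_coe_eq_iff] at hB
    simp only [eigen, Matrix.SpecialLinearGroup.coe_mul, Matrix.mul_apply, Fin.sum_univ_two]
    linear_combination A 1 0 * hB

theorem eigen_sq_eq {A B : SL(2, ℂ)} (h : (A : PSL(2, ℂ)) = B) (p : OnePoint ℂ) :
    eigen A p ^ 2 = eigen B p ^ 2 := by
  obtain ⟨ε, h1, h2⟩ := exists_smul_of_coe_eq h
  cases p with
  | infty =>
    simp only [eigen, h2]
    linear_combination B 0 0 ^ 2 * h1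
  | coe p =>
    simp only [eigen, h2]
    linear_combination (B 1 0 * p + B 1 1) ^ 2 * h1

theorem pow_eq_of_nilpotent {R : Type*} [Ring R] [Algebra ℂ R] {M N : R} {μ : ℂ}
    (hN : N * N = 0) (hM : M = μ • (1 + μ • N)) (k : ℕ) :
    M ^ k = μ ^ k • (1 + (k * μ) • N) := by
  induction k with
  | zero => simp
  | succ k ih =>
    rw [pow_succ, ih, hM, smul_mul_smul_comm, ← pow_succ, mul_add, mul_one, add_mul, smul_mul_smul_comm, hN,
      one_mul, smul_zero, add_zero, add_assoc, ← add_smul, Nat.cast_succ, add_one_mul]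

/-- An element of finite order of `PSL(2, ℂ)` with trace `± 2` is trivial. -/
theorem coe_eq_one_of_trace {A : SL(2, ℂ)} (htr : (A 0 0 + A 1 1) ^ 2 = 4)
    (hfin : IsOfFinOrder (A : PSL(2, ℂ))) : (A : PSL(2, ℂ)) = 1 := by
  obtain ⟨n, hn, hpow⟩ := hfin.exists_pow_eq_one
  have hd := sl_det A
  set μ := (A 0 0 + A 1 1) / 2 with hμ
  have hμ2 : μ ^ 2 = 1 := by rw [hμ, div_pow, htr]; norm_num
  have hμ0 : μ ≠ 0 := by
    intro h
    simp [h] at hμ2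
  have htr' : A 0 0 + A 1 1 = 2 * μ := by rw [hμ]; ring
  -- Cayley–Hamilton: trace `2 * μ` and determinant `1 = μ ^ 2` make the characteristic polynomial
  -- `(t - μ) ^ 2`.
  have hN : (A.1 - μ • 1) * (A.1 - μ • 1) = 0 := by
    ext i j
    fin_cases i <;> fin_cases j <;>
      simp [Matrix.mul_apply, Fin.sum_univ_two, -mul_eq_zero]
    · linear_combination A 0 0 * htr' - hd + hμ2
    · linear_combination A 0 1 * htr'
    · linear_combination A 1 0 * htr'
    · linear_combination A 1 1 * htr' - hd + hμ2
  have hpowk : ∀ k : ℕ, A.1 ^ k = μ ^ k • (1 + (k * μ) • (A.1 - μ • 1)) := by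
    refine fun k => pow_eq_of_nilpotent hN ?_ k
    rw [smul_add, smul_smul, ← sq, hμ2, one_smul, add_sub_cancel]
  obtain ⟨ε, -, hε⟩ := exists_smul_of_coe_eq (A := A ^ n) (B := 1)
    (by rw [QuotientGroup.mk_pow, hpow]; rfl)
  have hε' : ∀ i j, μ ^ n * ((1 : Matrix (Fin 2) (Fin 2) ℂ) i j +
      (n * μ) * (A i j - μ * (1 : Matrix (Fin 2) (Fin 2) ℂ) i j)) =
      ε * (1 : Matrix (Fin 2) (Fin 2) ℂ) i j := by
    intro i j
    have := hε i j
    rw [Matrix.SpecialLinearGroup.coe_pow, hpowk] at this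
    simpa using! this
  have hμn : μ ^ n ≠ 0 := pow_ne_zero n hμ0
  -- Since `n * μ ≠ 0`, scalarity of `A ^ n` forces `A` to be scalar.
  have hn0 : (n : ℂ) * μ ≠ 0 := mul_ne_zero (by exact_mod_cast hn.ne') hμ0
  have h01 : A 0 1 = 0 := by simpa [hμ0, hn.ne'] using hε' 0 1
  have h10 : A 1 0 = 0 := by simpa [hμ0, hn.ne'] using hε' 1 0
  have h00 := hε' 0 0
  have h11 := hε' 1 1
  simp only [Matrix.one_apply_eq, mul_one] at h00 h11
  have h : A 0 0 = A 1 1 := by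
    apply mul_left_cancel₀ (mul_ne_zero hμn hn0)
    linear_combination h00 - h11
  refine (QuotientGroup.eq_one_iff A).mpr (Matrix.SpecialLinearGroup.mem_center_iff.mpr
    ⟨A 0 0, ?_, ?_⟩)
  · rw [Fintype.card_fin]
    linear_combination hd + A 0 0 * h + A 0 1 * h10
  · ext i j
    fin_cases i <;> fin_cases j <;> simp [h01, h10, h]

/-- Fixed points solve a quadratic of discriminant `tr ^ 2 - 4`, which is nonzero by
`coe_eq_one_of_trace`. When `A 1 0 = 0`, one of the two roots is `∞`. -/
theorem exists_fixedPoints {g : PSL(2, ℂ)} (hg : IsOfFinOrder g) (h1 : g ≠ 1) :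
    ∃ p q : OnePoint ℂ, p ≠ q ∧ ∀ r : OnePoint ℂ, g • r = r ↔ r = p ∨ r = q := by
  obtain ⟨A, rfl⟩ := QuotientGroup.mk_surjective g
  have hd := sl_det A
  have htr : (A 0 0 + A 1 1) ^ 2 ≠ 4 := fun h => h1 (coe_eq_one_of_trace h hg)
  by_cases hc : A 1 0 = 0
  · have hne : A 0 0 - A 1 1 ≠ 0 := by
      intro h
      apply htr
      linear_combination (A 0 0 - A 1 1) * h + 4 * hd + 4 * A 0 1 * hc
    refine ⟨OnePoint.infty, ((A 0 1 / (A 1 1 - A 0 0) : ℂ) : OnePoint ℂ), by simp, fun r => ?_⟩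
    have hne' : A 1 1 - A 0 0 ≠ 0 := fun h => hne (by linear_combination -h)
    cases r with
    | infty => simpa using (smul_infty_eq_iff A).mpr hc
    | coe r =>
      rw [smul_coe_eq_iff]
      simp only [hc, OnePoint.coe_ne_infty, false_or, OnePoint.coe_eq_coe]
      rw [eq_div_iff hne']
      constructor <;> intro h <;> linear_combination -h
  · obtain ⟨s, hs⟩ := IsAlgClosed.exists_pow_nat_eq ((A 0 0 + A 1 1) ^ 2 - 4) (n := 2) (by norm_num)
    have hs0 : s ≠ 0 := by
      rintro rfl
      apply htr
      linear_combination -hs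
    refine ⟨(((A 0 0 - A 1 1 + s) / (2 * A 1 0) : ℂ) : OnePoint ℂ),
      (((A 0 0 - A 1 1 - s) / (2 * A 1 0) : ℂ) : OnePoint ℂ), ?_, fun r => ?_⟩
    · rw [Ne, OnePoint.coe_eq_coe, div_left_inj' (by simpa using hc)]
      intro h
      apply hs0
      linear_combination h / 2
    · cases r with
      | infty => simpa using (smul_infty_eq_iff A).not.mpr hc
      | coe r =>
        rw [smul_coe_eq_iff, OnePoint.coe_eq_coe, OnePoint.coe_eq_coe,
          eq_div_iff (by simpa using hc), eq_div_iff (by simpa using hc), ← sub_eq_zero (a := r * _),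
          ← sub_eq_zero (a := r * _) (b := A 0 0 - A 1 1 - s), ← mul_eq_zero]
        have e : (r * (2 * A 1 0) - (A 0 0 - A 1 1 + s)) * (r * (2 * A 1 0) - (A 0 0 - A 1 1 - s)) =
            4 * A 1 0 * (r * (A 1 0 * r + A 1 1) - (A 0 0 * r + A 0 1)) := by
          linear_combination -hs - 4 * hd
        rw [e, mul_eq_zero, or_iff_right (by simpa using hc), sub_eq_zero, eq_comm]

/-! ### Stabilizers are cyclic. -/

section

variable (G : Subgroup PSL(2, ℂ)) (p : OnePoint ℂ)

theorem stabilizer_smul (g : MulAction.stabilizer G p) :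
    ((g : G) : PSL(2, ℂ)) • p = p := g.2

/-- The square of the eigenvalue on the line `p`, as a character of the stabilizer of `p`. -/
def stabChar : MulAction.stabilizer G p →* ℂ where
  toFun g := eigen (lift ((g : G) : PSL(2, ℂ))) p ^ 2
  map_one' := by
    rw [eigen_sq_eq (B := 1) (by simp)]
    cases p with
    | infty => simp [eigen]
    | coe p => simp [eigen]
  map_mul' g h := by
    have hg : ((lift ((g : G) : PSL(2, ℂ)) : SL(2, ℂ)) : PSL(2, ℂ)) • p = p := by
      rw [coe_lift]; exact stabilizer_smul G p g
    have hh : ((lift ((h : G) : PSL(2, ℂ)) : SL(2, ℂ)) : PSL(2, ℂ)) • p = p := by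
      rw [coe_lift]; exact stabilizer_smul G p h
    rw [← mul_pow, ← eigen_mul hh]
    exact eigen_sq_eq (by simp) p

/-- If `μ ^ 2 = 1`, then `tr * μ = μ ^ 2 + 1 = 2`, so `tr ^ 2 = 4`; finite order then leaves only
the identity. -/
theorem stabChar_injective [Finite G] : Function.Injective (stabChar G p) := by
  rw [injective_iff_map_eq_one]
  intro g hg
  have hg' : ((lift ((g : G) : PSL(2, ℂ)) : SL(2, ℂ)) : PSL(2, ℂ)) • p = p := by
    rw [coe_lift]; exact stabilizer_smul G p g
  have h1 : eigen (lift ((g : G) : PSL(2, ℂ))) p ^ 2 = 1 := hg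
  have h2 := trace_mul_eigen hg'
  have h3 : IsOfFinOrder ((g : G) : PSL(2, ℂ)) :=
    Submonoid.isOfFinOrder_coe.mpr (isOfFinOrder_of_finite (g : G))
  have h4 := coe_eq_one_of_trace (A := lift ((g : G) : PSL(2, ℂ))) (by
    have := congrArg (· ^ 2) h2
    simp only [mul_pow, h1] at this
    linear_combination this) (by rwa [coe_lift])
  rw [coe_lift] at h4
  exact Subtype.ext (Subtype.ext h4)

theorem isCyclic_stabilizer [Finite G] : IsCyclic (MulAction.stabilizer G p) :=
  isCyclic_of_injective_ringHom (stabChar G p) (stabChar_injective G p)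

end

/-! ### Multiplicity equals the order of the stabilizer. -/

section

variable {G : Subgroup PSL(2, ℂ)} {u : RatFunc ℂ}

/-- With `φ = z ^ m * ψ` the expression of `u` at `p` and `γ` that of `g`, invariance says `φ ∘ γ =
φ` near `0`. Dividing by `z ^ m` and letting `z → 0` gives `γ'(0) ^ m = 1`, where `γ'(0) = μ⁻²`. -/
theorem IsInvariantGenerator.stabChar_pow (hu : IsInvariantGenerator G u) {p : OnePoint ℂ}
    {m : ℕ} (hm : mult u p = m) (g : MulAction.stabilizer G p) : stabChar G p g ^ m = 1 := by
  set A := lift ((g : G) : PSL(2, ℂ)) with hAdef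
  have hA : (A : PSL(2, ℂ)) • p = p := by
    rw [hAdef, coe_lift]; exact stabilizer_smul G p g
  have hμ := eigen_ne_zero hA
  obtain ⟨c, hc⟩ := exists_smul_localParam hA
  have hchar : stabChar G p g = eigen A p ^ 2 := rfl
  set μ := eigen A p
  have hφ := (holAt_toMap u p).analyticAt_chart.1
  obtain ⟨ψ, hψ, hψ0, hψz⟩ := (hφ.analyticOrderAt_eq_natCast (n := m)).mp hm
  simp only [sub_zero, smul_eq_mul] at hψz
  have hden : Tendsto (fun z : ℂ => μ + c * z) (𝓝 0) (𝓝 μ) := by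
    have : Continuous fun z : ℂ => μ + c * z := by fun_prop
    simpa using this.tendsto 0
  have hγ : Tendsto (fun z : ℂ => μ⁻¹ * z / (μ + c * z)) (𝓝 0) (𝓝 0) := by
    have h1 : Tendsto (fun z : ℂ => μ⁻¹ * z) (𝓝 0) (𝓝 0) := by
      have : Continuous fun z : ℂ => μ⁻¹ * z := by fun_prop
      simpa using this.tendsto 0
    simpa using! h1.div hden hμ
  have hinv : ∀ z, μ + c * z ≠ 0 →
      chart (toMap u) p (μ⁻¹ * z / (μ + c * z)) = chart (toMap u) p z := by
    intro z hz
    rw [chart, chart, ← hc z hz, hAdef, coe_lift, hu.toMap_smul (g : G).2]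
  have key : ∀ᶠ z in 𝓝[≠] (0 : ℂ),
      (μ⁻¹ / (μ + c * z)) ^ m * ψ (μ⁻¹ * z / (μ + c * z)) = ψ z := by
    filter_upwards [nhdsWithin_le_nhds hψz, nhdsWithin_le_nhds (hγ.eventually hψz),
      nhdsWithin_le_nhds (hden.eventually_ne hμ), self_mem_nhdsWithin] with z h1 h2 h3 h4
    have h5 := hinv z h3
    rw [h1, h2] at h5
    have h6 : z ^ m ≠ 0 := pow_ne_zero m h4
    apply mul_left_cancel₀ h6
    rw [← h5, ← mul_assoc, ← mul_pow]
    ring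
  have l1 : Tendsto (fun z => (μ⁻¹ / (μ + c * z)) ^ m * ψ (μ⁻¹ * z / (μ + c * z))) (𝓝[≠] 0)
      (𝓝 ((μ⁻¹ / μ) ^ m * ψ 0)) :=
    (((tendsto_const_nhds.div hden hμ).pow m).mul
      (hψ.continuousAt.tendsto.comp hγ)).mono_left nhdsWithin_le_nhds
  have l2 : Tendsto ψ (𝓝[≠] 0) (𝓝 (ψ 0)) := hψ.continuousAt.tendsto.mono_left nhdsWithin_le_nhds
  have h7 := tendsto_nhds_unique_of_eventuallyEq l1 l2 key
  have h8 : (μ⁻¹ / μ) ^ m = 1 := mul_right_cancel₀ hψ0 (by rw [h7, one_mul])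
  have h9 : μ⁻¹ / μ = (μ ^ 2)⁻¹ := by field_simp
  rw [h9, inv_pow, inv_eq_one] at h8
  rw [hchar, h8]

/-- The multiplicity of `u` at `p` is the order of the stabilizer of `p`. -/
theorem IsInvariantGenerator.mult_eq_card [Finite G] (hu : IsInvariantGenerator G u)
    (p : OnePoint ℂ) : mult u p = (Nat.card (MulAction.stabilizer G p) : ℕ∞) := by
  have hle := hu.mult_le p
  obtain ⟨m, hm⟩ := ENat.ne_top_iff_exists.mp (ne_top_of_le_ne_top (ENat.natCast_ne_top _) hle)
  have hm0 : m ≠ 0 := by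
    rintro rfl
    exact mult_ne_zero u p hm.symm
  rw [← hm, Nat.cast_le] at hle
  rw [← hm, Nat.cast_inj]
  refine le_antisymm hle ?_
  obtain ⟨g, hg⟩ := (isCyclic_stabilizer G p).exists_generator
  -- The character is faithful, so the generator satisfies `g ^ m = 1`, and the order of the
  -- stabilizer divides `m`.
  have h1 : g ^ m = 1 := stabChar_injective G p (by
    rw [map_pow, map_one, hu.stabChar_pow hm.symm])
  rw [← orderOf_eq_card_of_forall_mem_zpowers hg]
  exact Nat.le_of_dvd (Nat.pos_of_ne_zero hm0) (orderOf_dvd_of_pow_eq_one h1)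

end

/-! ### Counting fixed points and the Riemann–Hurwitz formula. -/

section

variable {G : Subgroup PSL(2, ℂ)} {u : RatFunc ℂ}

theorem IsInvariantGenerator.fiber_eq_orbit [Finite G] (hu : IsInvariantGenerator G u)
    (p : OnePoint ℂ) : {q | toMap u q = toMap u p} = MulAction.orbit G p := by
  ext q
  rw [Set.mem_ofPred_eq, eq_comm, hu.toMap_eq_iff]
  constructor
  · rintro ⟨g, hg, h⟩
    exact ⟨⟨g, hg⟩, h⟩
  · rintro ⟨g, h⟩
    exact ⟨g, g.2, h⟩

theorem IsInvariantGenerator.ncard_fiber_mul [Finite G] (hu : IsInvariantGenerator G u)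
    (p : OnePoint ℂ) :
    {q | toMap u q = toMap u p}.ncard * Nat.card (MulAction.stabilizer G p) = Nat.card G := by
  rw [hu.fiber_eq_orbit, ← MulAction.index_stabilizer, Subgroup.index_mul_card]

/-- Orbit–stabilizer: the two points share a fibre, and its size times either stabilizer order is
`|G|`. -/
theorem IsInvariantGenerator.card_stabilizer_congr [Finite G] (hu : IsInvariantGenerator G u)
    {p q : OnePoint ℂ} (h : toMap u p = toMap u q) :
    Nat.card (MulAction.stabilizer G p) = Nat.card (MulAction.stabilizer G q) := by
  have h1 := hu.ncard_fiber_mul p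
  have h2 := hu.ncard_fiber_mul q
  rw [h] at h1
  have h3 : {r | toMap u r = toMap u q}.ncard ≠ 0 := by
    intro h0
    rw [h0, zero_mul] at h2
    exact Nat.card_pos.ne h2
  exact Nat.eq_of_mul_eq_mul_left (Nat.pos_of_ne_zero h3) (h1.trans h2.symm)

theorem exists_fixedPoints_of_mem [Finite G] {g : G} (hg : g ≠ 1) :
    ∃ p q : OnePoint ℂ, p ≠ q ∧ ∀ r : OnePoint ℂ, g • r = r ↔ r = p ∨ r = q :=
  exists_fixedPoints (g := (g : PSL(2, ℂ)))
    (Submonoid.isOfFinOrder_coe.mpr (isOfFinOrder_of_finite g)) fun h => hg (Subtype.ext h)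

theorem one_lt_card_stabilizer_iff [Finite G] (p : OnePoint ℂ) :
    1 < Nat.card (MulAction.stabilizer G p) ↔ ∃ g : G, g ≠ 1 ∧ g • p = p := by
  rw [Finite.one_lt_card_iff_nontrivial, Subgroup.nontrivial_iff_exists_ne_one]
  exact ⟨fun ⟨g, h1, h2⟩ => ⟨g, h2, h1⟩, fun ⟨g, h1, h2⟩ => ⟨g, h2, h1⟩⟩

theorem finite_ramified [Finite G] :
    {p : OnePoint ℂ | 1 < Nat.card (MulAction.stabilizer G p)}.Finite := by
  have h : ∀ g : G, g ≠ 1 → {p : OnePoint ℂ | g • p = p}.Finite := by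
    intro g hg
    obtain ⟨p, q, -, h⟩ := exists_fixedPoints_of_mem hg
    simp only [h]
    exact (Set.finite_singleton q).insert p
  refine (Set.finite_iUnion fun g : {g : G // g ≠ 1} => h g g.2).subset fun p hp => ?_
  obtain ⟨g, h1, h2⟩ := (one_lt_card_stabilizer_iff p).mp hp
  exact Set.mem_iUnion.mpr ⟨⟨g, h1⟩, h2⟩

/-- Counting pairs of a nontrivial element and one of its fixed points in two ways. -/
theorem sum_card_stabilizer_sub_one [Finite G] :
    ∑ p ∈ (finite_ramified (G := G)).toFinset, (Nat.card (MulAction.stabilizer G p) - 1) =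
      2 * (Nat.card G - 1) := by
  classical
  have := Fintype.ofFinite G
  have key := Finset.sum_card_bipartiteAbove_eq_sum_card_bipartiteBelow
    (s := (Finset.univ.erase (1 : G))) (t := (finite_ramified (G := G)).toFinset)
    (fun g p => g • p = p)
  have h1 : ∀ g ∈ Finset.univ.erase (1 : G), (Finset.bipartiteAbove (fun (g : G) p => g • p = p)
      (finite_ramified (G := G)).toFinset g).card = 2 := by
    intro g hg
    obtain ⟨p, q, hpq, h⟩ := exists_fixedPoints_of_mem (Finset.ne_of_mem_erase hg)
    refine (congrArg Finset.card ?_).trans (Finset.card_pair hpq)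
    ext r
    simp only [Finset.mem_bipartiteAbove, Set.Finite.mem_toFinset, Set.mem_ofPred_eq,
      Finset.mem_insert, Finset.mem_singleton, ← h r]
    refine ⟨fun h => h.2, fun hr => ⟨?_, hr⟩⟩
    exact (one_lt_card_stabilizer_iff r).mpr ⟨g, Finset.ne_of_mem_erase hg, hr⟩
  have h2 : ∀ p : OnePoint ℂ, (Finset.bipartiteBelow (fun (g : G) p => g • p = p)
      (Finset.univ.erase (1 : G)) p).card = Nat.card (MulAction.stabilizer G p) - 1 := by
    intro p
    rw [Finset.bipartiteBelow, Finset.filter_erase, Finset.card_erase_of_mem (by simp),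
      Nat.card_eq_fintype_card, Fintype.card_subtype]
    rfl
  rw [Finset.sum_congr rfl h1, Finset.sum_congr rfl fun p _ => h2 p, Finset.sum_const,
    Finset.card_erase_of_mem (Finset.mem_univ _), Finset.card_univ, smul_eq_mul,
    ← Nat.card_eq_fintype_card] at key
  rw [← key, mul_comm]

/-- The common order of the stabilizers of the points over `b`. -/
def fiberMult (G : Subgroup PSL(2, ℂ)) (u : RatFunc ℂ) (b : OnePoint ℂ) : ℕ :=
  open Classical in
  if h : ∃ p, toMap u p = b then Nat.card (MulAction.stabilizer G h.choose) else 0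

theorem IsInvariantGenerator.card_stabilizer [Finite G] (hu : IsInvariantGenerator G u)
    (p : OnePoint ℂ) : Nat.card (MulAction.stabilizer G p) = fiberMult G u (toMap u p) := by
  have h : ∃ q, toMap u q = toMap u p := ⟨p, rfl⟩
  rw [fiberMult, dif_pos h]
  exact hu.card_stabilizer_congr h.choose_spec.symm

theorem IsInvariantGenerator.mult_eq_fiberMult [Finite G] (hu : IsInvariantGenerator G u)
    (p : OnePoint ℂ) : mult u p = fiberMult G u (toMap u p) := by
  rw [hu.mult_eq_card, hu.card_stabilizer]

theorem IsInvariantGenerator.branchValues_eq [Finite G] (hu : IsInvariantGenerator G u) :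
    branchValues u = toMap u '' {p | 1 < Nat.card (MulAction.stabilizer G p)} := by
  simp only [branchValues, hu.mult_eq_card, Nat.one_lt_cast]

theorem IsInvariantGenerator.finite_branchValues [Finite G] (hu : IsInvariantGenerator G u) :
    (branchValues u).Finite := by
  rw [hu.branchValues_eq]
  exact finite_ramified.image _

theorem IsInvariantGenerator.exists_of_mem_branchValues [Finite G]
    (hu : IsInvariantGenerator G u) {b : OnePoint ℂ} (hb : b ∈ branchValues u) :
    2 ≤ fiberMult G u b ∧
      ∃ p, toMap u p = b ∧ Nat.card (MulAction.stabilizer G p) = fiberMult G u b := by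
  rw [hu.branchValues_eq] at hb
  obtain ⟨p, hp, rfl⟩ := hb
  rw [← hu.card_stabilizer]
  exact ⟨hp, p, rfl, rfl⟩

theorem IsInvariantGenerator.mem_branchValues [Finite G] (hu : IsInvariantGenerator G u)
    {g : G} (hg : g ≠ 1) {p : OnePoint ℂ} (hp : g • p = p) : toMap u p ∈ branchValues u := by
  rw [hu.branchValues_eq]
  exact ⟨p, (one_lt_card_stabilizer_iff p).mpr ⟨g, hg, hp⟩, rfl⟩

theorem IsInvariantGenerator.fiberMult_le [Finite G] (hu : IsInvariantGenerator G u)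
    {b : OnePoint ℂ} (hb : b ∈ branchValues u) : fiberMult G u b ≤ Nat.card G := by
  obtain ⟨-, p, -, h⟩ := hu.exists_of_mem_branchValues hb
  rw [← h]
  exact Subgroup.card_le_card_group _

theorem IsInvariantGenerator.exists_orderOf_eq [Finite G] (hu : IsInvariantGenerator G u)
    {b : OnePoint ℂ} (hb : b ∈ branchValues u) : ∃ g : G, orderOf g = fiberMult G u b := by
  obtain ⟨-, p, -, h⟩ := hu.exists_of_mem_branchValues hb
  obtain ⟨g, hg⟩ := (isCyclic_stabilizer G p).exists_generator
  exact ⟨g, by rw [Subgroup.orderOf_coe, orderOf_eq_card_of_forall_mem_zpowers hg, h]⟩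

theorem IsInvariantGenerator.exists_orderOf_dvd [Finite G] (hu : IsInvariantGenerator G u)
    {g : G} (hg : g ≠ 1) : ∃ b ∈ branchValues u, orderOf g ∣ fiberMult G u b := by
  obtain ⟨p, q, -, h⟩ := exists_fixedPoints_of_mem hg
  have hp : g • p = p := (h p).mpr (Or.inl rfl)
  refine ⟨toMap u p, hu.mem_branchValues hg hp, ?_⟩
  rw [← hu.card_stabilizer]
  exact Subgroup.orderOf_dvd_natCard _ hp

/-- The Riemann–Hurwitz formula for `u`. -/
theorem IsInvariantGenerator.sum_fiberMult [Finite G] (hu : IsInvariantGenerator G u) :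
    ∑ b ∈ hu.finite_branchValues.toFinset, (1 - 1 / (fiberMult G u b : ℚ)) =
      2 - 2 / (Nat.card G : ℚ) := by
  classical
  have hN : (Nat.card G : ℚ) ≠ 0 := by exact_mod_cast Nat.card_pos.ne'
  have key := sum_card_stabilizer_sub_one (G := G)
  have hmaps : ∀ p ∈ (finite_ramified (G := G)).toFinset,
      toMap u p ∈ hu.finite_branchValues.toFinset := by
    intro p hp
    rw [Set.Finite.mem_toFinset] at hp ⊢
    rw [hu.branchValues_eq]
    exact ⟨p, hp, rfl⟩
  -- Group the ramified points by image: the fibre over `b` has `|G| / m_b` points, each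
  -- contributing `m_b - 1`.
  rw [← Finset.sum_fiberwise_of_maps_to hmaps] at key
  have h1 : ∀ b ∈ hu.finite_branchValues.toFinset,
      ((∑ p ∈ (finite_ramified (G := G)).toFinset with toMap u p = b,
        (Nat.card (MulAction.stabilizer G p) - 1) : ℕ) : ℚ) =
      Nat.card G * (1 - 1 / (fiberMult G u b : ℚ)) := by
    intro b hb
    rw [Set.Finite.mem_toFinset] at hb
    obtain ⟨hb2, p, rfl, hp⟩ := hu.exists_of_mem_branchValues hb
    have h2 : ((finite_ramified (G := G)).toFinset.filter fun q => toMap u q = toMap u p).card =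
        {q | toMap u q = toMap u p}.ncard := by
      rw [← Set.ncard_coe_finset]
      congr 1
      ext q
      simp only [Finset.coe_filter, Set.Finite.mem_toFinset, Set.mem_ofPred_eq, and_iff_right_iff_imp]
      intro hq
      rw [hu.card_stabilizer_congr hq, hp]
      exact hb2
    have h3 := hu.ncard_fiber_mul p
    rw [Finset.sum_congr rfl (g := fun _ => fiberMult G u (toMap u p) - 1) fun q hq => by
      rw [hu.card_stabilizer, (Finset.mem_filter.mp hq).2], Finset.sum_const, h2, smul_eq_mul,
      ← h3, hp]
    have h4 : (fiberMult G u (toMap u p) : ℚ) ≠ 0 := by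
      have : fiberMult G u (toMap u p) ≠ 0 := by omega
      exact_mod_cast this
    rw [Nat.cast_mul, Nat.cast_mul, Nat.cast_sub (by omega)]
    field_simp
    simp
  have h5 := congrArg (Nat.cast : ℕ → ℚ) key
  rw [Nat.cast_sum, Finset.sum_congr rfl h1, ← Finset.mul_sum, Nat.cast_mul,
    Nat.cast_sub Nat.card_pos] at h5
  apply mul_left_cancel₀ hN
  rw [h5]
  field_simp
  simp

end

/-! ### Arithmetic of the Riemann–Hurwitz equation. -/

section

variable {β : Type*} {B : Finset β} {m : β → ℕ} {N : ℕ}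

/-- Each summand lies between `1 / 2` and `1 - 1 / N`, while the total is `2 * (1 - 1 / N) < 2`. -/
theorem card_eq_two_or_three (hN : 2 ≤ N) (h2 : ∀ b ∈ B, 2 ≤ m b) (hmN : ∀ b ∈ B, m b ≤ N)
    (hsum : ∑ b ∈ B, (1 - 1 / (m b : ℚ)) = 2 - 2 / (N : ℚ)) : B.card = 2 ∨ B.card = 3 := by
  have hN' : (2 : ℚ) ≤ N := by exact_mod_cast hN
  have hNi : 0 < 1 / (N : ℚ) := by positivity
  have hNi2 : 1 / (N : ℚ) ≤ 1 / 2 := one_div_le_one_div_of_le (by norm_num) hN'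
  have hup : ∑ b ∈ B, (1 - 1 / (m b : ℚ)) ≤ B.card • (1 - 1 / (N : ℚ)) :=
    Finset.sum_le_card_nsmul _ _ _ fun b hb => by
      have h1 : (0 : ℚ) < m b := by exact_mod_cast (by linarith [h2 b hb] : 0 < m b)
      have h3 : (m b : ℚ) ≤ N := by exact_mod_cast hmN b hb
      linarith [one_div_le_one_div_of_le h1 h3]
  have hlow : B.card • (1 / 2 : ℚ) ≤ ∑ b ∈ B, (1 - 1 / (m b : ℚ)) :=
    Finset.card_nsmul_le_sum _ _ _ fun b hb => by
      have h1 : (2 : ℚ) ≤ m b := by exact_mod_cast h2 b hb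
      linarith [one_div_le_one_div_of_le (by norm_num) h1]
  rw [hsum, nsmul_eq_mul] at hup hlow
  have e : 2 / (N : ℚ) = 2 * (1 / (N : ℚ)) := by ring
  rw [e] at hup hlow
  have c1 : 2 ≤ B.card := by
    have : (2 : ℚ) ≤ B.card := by
      by_contra! hc
      nlinarith
    exact_mod_cast this
  have c2 : B.card < 4 := by
    have : (B.card : ℚ) < 4 := by linarith
    exact_mod_cast this
  omega

theorem eq_of_card_eq_two (h2 : ∀ b ∈ B, 2 ≤ m b) (hmN : ∀ b ∈ B, m b ≤ N)
    (hsum : ∑ b ∈ B, (1 - 1 / (m b : ℚ)) = 2 - 2 / (N : ℚ)) (hcard : B.card = 2) :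
    ∀ b ∈ B, m b = N := by
  have hle : ∀ b ∈ B, 1 - 1 / (m b : ℚ) ≤ 1 - 1 / (N : ℚ) := fun b hb => by
    have h1 : (0 : ℚ) < m b := by exact_mod_cast (by linarith [h2 b hb] : 0 < m b)
    have h3 : (m b : ℚ) ≤ N := by exact_mod_cast hmN b hb
    linarith [one_div_le_one_div_of_le h1 h3]
  have heq : ∑ b ∈ B, (1 - 1 / (m b : ℚ)) = ∑ b ∈ B, (1 - 1 / (N : ℚ)) := by
    rw [hsum, Finset.sum_const, hcard, nsmul_eq_mul]
    push_cast
    ring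
  intro b hb
  have := (Finset.sum_eq_sum_iff_of_le hle).mp heq b hb
  simpa using this

/-- The terms at `x` and `y` already exhaust the sum, and any further term would be positive. -/
theorem eq_pair [DecidableEq β] {x y : β} (hx : x ∈ B) (hy : y ∈ B) (hxy : x ≠ y)
    (h2 : ∀ b ∈ B, 2 ≤ m b) (hmx : m x = N) (hmy : m y = N)
    (hsum : ∑ b ∈ B, (1 - 1 / (m b : ℚ)) = 2 - 2 / (N : ℚ)) : B = {x, y} := by
  have hpos : ∀ b ∈ B, 0 < 1 - 1 / (m b : ℚ) := fun b hb => by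
    have h1 : (2 : ℚ) ≤ m b := by exact_mod_cast h2 b hb
    linarith [one_div_le_one_div_of_le (by norm_num) h1]
  refine (Finset.eq_of_subset_of_card_le ?_ ?_).symm
  · intro b hb
    rcases Finset.mem_insert.mp hb with rfl | hb
    · exact hx
    · rwa [Finset.mem_singleton.mp hb]
  by_contra! hc
  obtain ⟨b, hb, hb'⟩ := Finset.exists_mem_notMem_of_card_lt_card hc
  have hsub : insert b {x, y} ⊆ B := by
    intro c hc
    simp only [Finset.mem_insert, Finset.mem_singleton] at hc
    rcases hc with rfl | rfl | rfl <;> assumption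
  have h3 := Finset.sum_le_sum_of_subset_of_nonneg hsub fun c hc _ => (hpos c hc).le
  rw [hsum, Finset.sum_insert hb', Finset.sum_pair hxy, hmx, hmy] at h3
  have h4 := hpos b hb
  have e : 2 / (N : ℚ) = 2 * (1 / (N : ℚ)) := by ring
  linarith

/-- The reciprocals sum to more than `1`, which forces `x = 2`, then `y ≤ 3`, and `z < 6` when `y =
3`. The equation then determines `N`. -/
theorem triple_classification {x y z : ℕ} (hx : 2 ≤ x) (hxy : x ≤ y) (hyz : y ≤ z) (hN : 2 ≤ N)
    (h : 1 / (x : ℚ) + 1 / y + 1 / z = 1 + 2 / N) :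
    x = 2 ∧ ((y = 2 ∧ N = 2 * z) ∨ (y = 3 ∧ z = 3 ∧ N = 12) ∨ (y = 3 ∧ z = 4 ∧ N = 24) ∨
      (y = 3 ∧ z = 5 ∧ N = 60)) := by
  have hx0 : (2 : ℚ) ≤ x := by exact_mod_cast hx
  have hxy' : (x : ℚ) ≤ y := by exact_mod_cast hxy
  have hyz' : (y : ℚ) ≤ z := by exact_mod_cast hyz
  have hN0 : (2 : ℚ) ≤ N := by exact_mod_cast hN
  have hN1 : 0 < 2 / (N : ℚ) := by positivity
  have a1 : 1 / (y : ℚ) ≤ 1 / x := one_div_le_one_div_of_le (by linarith) hxy'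
  have a2 : 1 / (z : ℚ) ≤ 1 / y := one_div_le_one_div_of_le (by linarith) hyz'
  have hx2 : x = 2 := by
    by_contra hne
    have : (3 : ℚ) ≤ x := by exact_mod_cast (by omega : 3 ≤ x)
    have := one_div_le_one_div_of_le (by norm_num) this
    linarith
  subst hx2
  refine ⟨rfl, ?_⟩
  have hy3 : y ≤ 3 := by
    by_contra! hne
    have : (4 : ℚ) ≤ y := by exact_mod_cast hne
    have := one_div_le_one_div_of_le (by norm_num) this
    norm_num at h this
    norm_num at a2
    linarith
  have hz0 : (z : ℚ) ≠ 0 := by linarith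
  have hNne : (N : ℚ) ≠ 0 := by linarith
  interval_cases y
  · left
    refine ⟨rfl, ?_⟩
    have e : 1 / (z : ℚ) = 2 / N := by norm_num at h ⊢; linarith
    rw [div_eq_div_iff hz0 hNne] at e
    have : (N : ℚ) = 2 * z := by linarith
    exact_mod_cast this
  · right
    have hz6 : z < 6 := by
      by_contra! hne
      have : (6 : ℚ) ≤ z := by exact_mod_cast hne
      have := one_div_le_one_div_of_le (by norm_num) this
      norm_num at h this
      linarith
    interval_cases z
    · left
      have e : (1 : ℚ) / 6 = 2 / N := by norm_num at h ⊢; linarith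
      rw [div_eq_div_iff (by norm_num) hNne] at e
      exact ⟨rfl, rfl, by exact_mod_cast (by linarith : (N : ℚ) = 12)⟩
    · right; left
      have e : (1 : ℚ) / 12 = 2 / N := by norm_num at h ⊢; linarith
      rw [div_eq_div_iff (by norm_num) hNne] at e
      exact ⟨rfl, rfl, by exact_mod_cast (by linarith : (N : ℚ) = 24)⟩
    · right; right
      have e : (1 : ℚ) / 30 = 2 / N := by norm_num at h ⊢; linarith
      rw [div_eq_div_iff (by norm_num) hNne] at e
      exact ⟨rfl, rfl, by exact_mod_cast (by linarith : (N : ℚ) = 60)⟩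

theorem exists_sorted_enumeration {k : ℕ} (hcard : B.card = k) :
    ∃ b : Fin k → β, Function.Injective b ∧ Set.range b = B ∧ Monotone (m ∘ b) := by
  let e := (B.equivFinOfCardEq hcard).symm
  let σ := Tuple.sort fun i => m (e i)
  refine ⟨fun i => e (σ i), ?_, ?_, Tuple.monotone_sort fun i => m (e i)⟩
  · exact Subtype.val_injective.comp (e.injective.comp σ.injective)
  · ext b
    constructor
    · rintro ⟨i, rfl⟩
      exact (e (σ i)).2
    · intro hb
      exact ⟨σ.symm (e.symm ⟨b, hb⟩), by simp⟩

end

/-! ### Numbering the branch values. -/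

section

variable {G : Subgroup PSL(2, ℂ)} {u : RatFunc ℂ}

theorem two_le_card_of_ne_bot [Finite G] (h : G ≠ ⊥) : 2 ≤ Nat.card G := by
  have : Nontrivial G := (Subgroup.nontrivial_iff_ne_bot G).mpr h
  exact Finite.one_lt_card

theorem IsInvariantGenerator.hasBranchMultiplicities [Finite G] (hu : IsInvariantGenerator G u)
    {k : ℕ} {m : Fin k → ℕ} {b : Fin k → OnePoint ℂ} (hb : Function.Injective b)
    (hr : Set.range b = branchValues u) (hm : ∀ i, fiberMult G u (b i) = m i) :
    HasBranchMultiplicities u m :=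
  ⟨b, hb, hr, fun i p hp => by rw [hu.mult_eq_fiberMult, hp, hm]⟩

/-- The two fixed points of a generator are fixed by all of `G`, so they are distinct orbits of
index `|G|`; `eq_pair` excludes further branch values. -/
theorem IsInvariantGenerator.cyclic_case [Finite G] (hu : IsInvariantGenerator G u)
    (hcyc : IsCyclic G) (hG : G ≠ ⊥) : HasBranchMultiplicities u ![Nat.card G, Nat.card G] := by
  classical
  obtain ⟨g, hg⟩ := hcyc.exists_generator
  have hN := two_le_card_of_ne_bot hG
  have hg1 : g ≠ 1 := by
    rintro rfl
    have := orderOf_eq_card_of_forall_mem_zpowers hg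
    rw [orderOf_one] at this
    omega
  obtain ⟨p, q, hpq, hfix⟩ := exists_fixedPoints_of_mem hg1
  have hall : ∀ r : OnePoint ℂ, g • r = r → MulAction.stabilizer G r = ⊤ := by
    intro r hr
    rw [eq_top_iff]
    intro x _
    have : Subgroup.zpowers g ≤ MulAction.stabilizer G r := by
      rw [Subgroup.zpowers_le]
      exact hr
    exact this (hg x)
  have hmN : ∀ r : OnePoint ℂ, g • r = r → fiberMult G u (toMap u r) = Nat.card G := by
    intro r hr
    rw [← hu.card_stabilizer, hall r hr, Subgroup.card_top]
  have hp : g • p = p := (hfix p).mpr (Or.inl rfl)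
  have hq : g • q = q := (hfix q).mpr (Or.inr rfl)
  have hne : toMap u p ≠ toMap u q := by
    intro h
    obtain ⟨x, hx, h1⟩ := hu.toMap_eq_iff.mp h
    have h2 : (⟨x, hx⟩ : G) ∈ MulAction.stabilizer G p := by
      rw [hall p hp]
      trivial
    exact hpq (Eq.trans (Eq.symm h2) h1)
  have hB := eq_pair (B := hu.finite_branchValues.toFinset) (m := fiberMult G u)
    (N := Nat.card G) (x := toMap u p) (y := toMap u q)
    (by simpa using hu.mem_branchValues hg1 hp) (by simpa using hu.mem_branchValues hg1 hq) hne
    (fun b hb => (hu.exists_of_mem_branchValues (by simpa using hb)).1) (hmN p hp) (hmN q hq)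
    hu.sum_fiberMult
  have hB' : branchValues u = {toMap u p, toMap u q} := by
    rw [← hu.finite_branchValues.coe_toFinset, hB]
    simp
  refine hu.hasBranchMultiplicities (b := ![toMap u p, toMap u q]) ?_ ?_ ?_
  · intro i j h
    fin_cases i <;> fin_cases j <;> simp_all
  · rw [hB']
    simp [Set.pair_comm]
  · intro i
    fin_cases i
    · exact hmN p hp
    · exact hmN q hq

theorem IsInvariantGenerator.noncyclic_case [Finite G] (hu : IsInvariantGenerator G u)
    (hcyc : ¬ IsCyclic G) : ∃ b : Fin 3 → OnePoint ℂ, Function.Injective b ∧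
      Set.range b = branchValues u ∧ fiberMult G u (b 0) = 2 ∧
      ((fiberMult G u (b 1) = 2 ∧ Nat.card G = 2 * fiberMult G u (b 2)) ∨
        (fiberMult G u (b 1) = 3 ∧ fiberMult G u (b 2) = 3 ∧ Nat.card G = 12) ∨
        (fiberMult G u (b 1) = 3 ∧ fiberMult G u (b 2) = 4 ∧ Nat.card G = 24) ∨
        (fiberMult G u (b 1) = 3 ∧ fiberMult G u (b 2) = 5 ∧ Nat.card G = 60)) := by
  have hG : G ≠ ⊥ := by
    rintro rfl
    exact hcyc inferInstance
  have hN := two_le_card_of_ne_bot hG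
  have h2 : ∀ b ∈ hu.finite_branchValues.toFinset, 2 ≤ fiberMult G u b := fun b hb =>
    (hu.exists_of_mem_branchValues (by simpa using hb)).1
  have hmN : ∀ b ∈ hu.finite_branchValues.toFinset, fiberMult G u b ≤ Nat.card G := fun b hb =>
    hu.fiberMult_le (by simpa using hb)
  rcases card_eq_two_or_three hN h2 hmN hu.sum_fiberMult with hc | hc
  -- With two branch values the indices equal `|G|`, so some element has order `|G|` and `G` is
  -- cyclic.
  · exfalso
    obtain ⟨b, hb⟩ := Finset.card_pos.mp (by rw [hc]; norm_num)
    obtain ⟨g, hg⟩ := hu.exists_orderOf_eq (b := b) (by simpa using hb)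
    rw [eq_of_card_eq_two h2 hmN hu.sum_fiberMult hc b hb] at hg
    exact hcyc (isCyclic_of_orderOf_eq_card g hg)
  · obtain ⟨b, hb, hr, hmono⟩ := exists_sorted_enumeration (m := fiberMult G u) hc
    rw [hu.finite_branchValues.coe_toFinset] at hr
    refine ⟨b, hb, hr, ?_⟩
    have hsum := hu.sum_fiberMult
    have himg : hu.finite_branchValues.toFinset = Finset.univ.map ⟨b, hb⟩ := by
      ext x
      simp [← hr]
    rw [himg, Finset.sum_map, Fin.sum_univ_three] at hsum
    simp only [Function.Embedding.coeFn_mk] at hsum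
    refine triple_classification ?_ (hmono (by decide : (0 : Fin 3) ≤ 1))
      (hmono (by decide : (1 : Fin 3) ≤ 2)) hN (by linarith)
    exact (hu.exists_of_mem_branchValues (by rw [← hr]; exact ⟨0, rfl⟩)).1

theorem HasBranchMultiplicities.ncard_branchValues {k : ℕ} {m : Fin k → ℕ}
    (h : HasBranchMultiplicities u m) : (branchValues u).ncard = k := by
  obtain ⟨b, hb, hr, -⟩ := h
  rw [← hr, ← Set.image_univ, Set.ncard_image_of_injective _ hb, Set.ncard_univ, Nat.card_fin]

end

/-! ### Element orders and the dihedral and polyhedral groups. -/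

set_option maxRecDepth 10000 in
theorem orderOf_perm_four (x : Equiv.Perm (Fin 4)) : orderOf x ≤ 4 := by
  have h : ∀ x : Equiv.Perm (Fin 4), x ^ 4 = 1 ∨ x ^ 3 = 1 := by decide
  rcases h x with h | h
  · exact orderOf_le_of_pow_eq_one (by norm_num) h
  · exact (orderOf_le_of_pow_eq_one (by norm_num) h).trans (by norm_num)

set_option maxRecDepth 10000 in
theorem orderOf_perm_five (x : Equiv.Perm (Fin 5)) : orderOf x ≤ 6 := by
  have h : ∀ x : Equiv.Perm (Fin 5), x ^ 4 = 1 ∨ x ^ 5 = 1 ∨ x ^ 6 = 1 := by decide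
  rcases h x with h | h | h <;>
    exact (orderOf_le_of_pow_eq_one (by norm_num) h).trans (by norm_num)

theorem not_isCyclic_of_orderOf_le {H : Type*} [Group H] {k : ℕ} (hk : k < Nat.card H)
    (h : ∀ x : H, orderOf x ≤ k) : ¬ IsCyclic H := by
  intro hcyc
  obtain ⟨g, hg⟩ := hcyc.exists_generator
  have h1 := h g
  rw [orderOf_eq_card_of_forall_mem_zpowers hg] at h1
  omega

section

variable {G : Subgroup PSL(2, ℂ)} {u : RatFunc ℂ}

theorem IsInvariantGenerator.dihedral_case [Finite G] (hu : IsInvariantGenerator G u) {n : ℕ}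
    (hn : 2 ≤ n) (e : G ≃* DihedralGroup n) : HasBranchMultiplicities u ![2, 2, n] := by
  have hcyc : ¬ IsCyclic G := fun h =>
    DihedralGroup.not_isCyclic (by omega) (e.isCyclic.mp h)
  have hcard : Nat.card G = 2 * n := by
    rw [Nat.card_congr e.toEquiv, DihedralGroup.nat_card]
  obtain ⟨b, hb, hr, h0, h12⟩ := hu.noncyclic_case hcyc
  obtain ⟨g, hg⟩ : ∃ g : G, orderOf g = n :=
    ⟨e.symm (DihedralGroup.r 1), by rw [MulEquiv.orderOf_eq, DihedralGroup.orderOf_r_one]⟩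
  have hg1 : g ≠ 1 := by
    rintro rfl
    rw [orderOf_one] at hg
    omega
  -- The rotation of order `n` forces an index at least `n`. This excludes the polyhedral triples:
  -- orders 12, 24, 60 mean `n` = 6, 12, 30, above the largest indices 3, 4, 5.
  obtain ⟨c, hc, hdvd⟩ := hu.exists_orderOf_dvd hg1
  rw [← hr] at hc
  obtain ⟨i, rfl⟩ := hc
  have hle := Nat.le_of_dvd (by
    have := (hu.exists_of_mem_branchValues (b := b i) (by rw [← hr]; exact ⟨i, rfl⟩)).1
    omega) hdvd
  rw [hg] at hle
  have hcases : fiberMult G u (b i) = fiberMult G u (b 0) ∨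
      fiberMult G u (b i) = fiberMult G u (b 1) ∨ fiberMult G u (b i) = fiberMult G u (b 2) := by
    fin_cases i <;> simp
  refine hu.hasBranchMultiplicities hb hr fun j => ?_
  fin_cases j <;> simp <;> omega

/-- The largest index is the order of an element, hence at most `k`; as `2 * k < |G|`, it is not
`|G| / 2`, which rules out the type (2,2,n). The group order then selects the triple. -/
theorem IsInvariantGenerator.polyhedral_case [Finite G] (hu : IsInvariantGenerator G u)
    {H : Type*} [Group H] (e : G ≃* H) {k : ℕ} (hk : 2 * k < Nat.card H)
    (hord : ∀ x : H, orderOf x ≤ k) :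
    (Nat.card H = 12 → HasBranchMultiplicities u ![3, 3, 2]) ∧
      (Nat.card H = 24 → HasBranchMultiplicities u ![4, 3, 2]) ∧
      (Nat.card H = 60 → HasBranchMultiplicities u ![5, 3, 2]) := by
  have hcyc : ¬ IsCyclic G := fun h =>
    not_isCyclic_of_orderOf_le (by omega) hord (e.isCyclic.mp h)
  have hcard : Nat.card G = Nat.card H := Nat.card_congr e.toEquiv
  obtain ⟨b, hb, hr, h0, h12⟩ := hu.noncyclic_case hcyc
  obtain ⟨g, hg⟩ := hu.exists_orderOf_eq (b := b 2) (by rw [← hr]; exact ⟨2, rfl⟩)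
  have hle := hord (e g)
  rw [MulEquiv.orderOf_eq, hg] at hle
  -- The enumeration is increasing while the required triples decrease, hence the reversal.
  have hr' : Set.range (b ∘ Fin.rev) = branchValues u := by
    rw [Fin.rev_surjective.range_comp, hr]
  refine ⟨fun h => ?_, fun h => ?_, fun h => ?_⟩ <;>
  · refine hu.hasBranchMultiplicities (hb.comp Fin.rev_injective) hr' fun j => ?_
    fin_cases j <;> simp [Fin.rev] <;> omega

end

end MobiusInvariant

end

theorem mainTheorem8 (G : Subgroup PSL(2, ℂ)) (hG : Finite G) (u : RatFunc ℂ)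
    (hu : MobiusInvariant.IsInvariantGenerator G u) :
    ((¬ IsCyclic G → (MobiusInvariant.branchValues u).ncard = 3) ∧
      (IsCyclic G → G ≠ ⊥ → (MobiusInvariant.branchValues u).ncard = 2)) ∧
    (∀ p q : OnePoint ℂ, MobiusInvariant.toMap u p = MobiusInvariant.toMap u q →
      MobiusInvariant.mult u p = MobiusInvariant.mult u q) ∧
    ((∀ n : ℕ, 2 ≤ n → Nonempty (G ≃* Multiplicative (ZMod n)) →
        MobiusInvariant.HasBranchMultiplicities u ![n, n]) ∧
      (∀ n : ℕ, 2 ≤ n → Nonempty (G ≃* DihedralGroup n) →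
        MobiusInvariant.HasBranchMultiplicities u ![2, 2, n]) ∧
      (Nonempty (G ≃* alternatingGroup (Fin 4)) →
        MobiusInvariant.HasBranchMultiplicities u ![3, 3, 2]) ∧
      (Nonempty (G ≃* Equiv.Perm (Fin 4)) →
        MobiusInvariant.HasBranchMultiplicities u ![4, 3, 2]) ∧
      (Nonempty (G ≃* alternatingGroup (Fin 5)) →
        MobiusInvariant.HasBranchMultiplicities u ![5, 3, 2])) := by
  have hcardA4 : Nat.card (alternatingGroup (Fin 4)) = 12 := by
    rw [nat_card_alternatingGroup, Nat.card_fin]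
    decide
  have hcardS4 : Nat.card (Equiv.Perm (Fin 4)) = 24 := by
    rw [Nat.card_perm, Nat.card_fin]
    decide
  have hcardA5 : Nat.card (alternatingGroup (Fin 5)) = 60 := by
    rw [nat_card_alternatingGroup, Nat.card_fin]
    decide
  refine ⟨⟨fun hcyc => ?_, fun hcyc hbot => ?_⟩, fun p q h => ?_, fun n hn ⟨e⟩ => ?_,
    fun n hn ⟨e⟩ => ?_, fun ⟨e⟩ => ?_, fun ⟨e⟩ => ?_, fun ⟨e⟩ => ?_⟩
  · obtain ⟨b, hb, hr, -⟩ := hu.noncyclic_case hcyc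
    exact (hu.hasBranchMultiplicities hb hr fun _ => rfl).ncard_branchValues
  · exact (hu.cyclic_case hcyc hbot).ncard_branchValues
  · rw [hu.mult_eq_fiberMult, hu.mult_eq_fiberMult, h]
  · have hcard : Nat.card G = n := by
      rw [Nat.card_congr e.toEquiv, Nat.card_congr Multiplicative.toAdd, Nat.card_zmod]
    have hbot : G ≠ ⊥ := by
      rintro rfl
      rw [Subgroup.card_bot] at hcard
      omega
    have := hu.cyclic_case (e.isCyclic.mpr inferInstance) hbot
    rwa [hcard] at this
  · exact hu.dihedral_case hn e
  · refine (hu.polyhedral_case e (k := 4) (by rw [hcardA4]; norm_num) fun x => ?_).1 hcardA4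
    rw [← Subgroup.orderOf_coe]
    exact MobiusInvariant.orderOf_perm_four x
  · exact (hu.polyhedral_case e (k := 4) (by rw [hcardS4]; norm_num)
      MobiusInvariant.orderOf_perm_four).2.1 hcardS4
  · refine (hu.polyhedral_case e (k := 6) (by rw [hcardA5]; norm_num) fun x => ?_).2.2 hcardA5
    rw [← Subgroup.orderOf_coe]
    exact MobiusInvariant.orderOf_perm_five x
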